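/- Let $M$ be a smooth closed manifold of dimension $n$ (compact, Hausdorff, without boundary), foliated by an integrable sub-bundle $H\subset TM$ of rank $p$; that is, near every point there are foliation coordinates $x=(x_1,\dots,x_n)$ in which $H$ is spanned by $\partial_1,\dots,\partial_p$. For a multi-index $\alpha$ put $\|\alpha\|=\alpha_1+\cdots+\alpha_p+2(\alpha_{p+1}+\cdots+\alpha_n)$. Let $E,F,G$ be smooth complex vector bundles of finite rank over $M$ with smooth Hermitian metrics, let $M$ carry a smooth positive density, and let $\|\cdot\|$ denote the resulting $L^2$ norms of sections. A differential operator between sections of two such bundles has weighted order $\le d$ ($d\in\mathbb{Z}_{\ge 0}$) if in all foliation coordinates and local trivializations it has the form $\sum_{\|\alpha\|\le d}a_\alpha(x)\,\partial^\alpha$ with smooth matrix-valued coefficients $a_\alpha$; its weighted principal symbol (in degree $d$) is then $$\sigma_H(x,\xi)=\sum_{\|\alpha\|=d}a_\alpha(x)\,(i\xi)^\alpha .$$ Let $P\colon C^\infty(E)\to C^\infty(F)$ be a differential operator of weighted order $\le d$ whose weighted principal symbol $\sigma_H(P)(x,\xi)$ in degree $d$ is invertible for all $x\in M$ and all $\xi\neq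 0$. Then for every differential operator $A\colon C^\infty(E)\to C^\infty(G)$ of weighted order $\le d$ there is a constant $C>0$ such that $$\|Au\|\le C\,(\|Pu\|+\|u\|)\qquad\text{for every smooth section } u\in C^\infty(E).$$ -/

import Mathlib

open Bundle MeasureTheory
open scoped Manifold ContDiff

noncomputable section

namespace WeightedCalculus

/-! ### Foliations -/

section Foliation

variable {n : ℕ} {M : Type*} [TopologicalSpace M] [ChartedSpace (EuclideanSpace ℝ (Fin n)) M]

/-- `φ` is a foliation chart for the field `H` of tangent subspaces: a smooth chart of `M` in which
`H` is spanned by the first `p` coordinate vector fields, that is, the differential of `φ` maps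
`H x` onto the span of the first `p` standard basis vectors, for every `x` in the domain of `φ`. -/
def IsFoliationChart (p : ℕ) (H : ∀ x : M, Submodule ℝ (TangentSpace (𝓡 n) x))
    (φ : OpenPartialHomeomorph M (EuclideanSpace ℝ (Fin n))) : Prop :=
  φ ∈ IsManifold.maximalAtlas (𝓡 n) ∞ M ∧
    ∀ x ∈ φ.source,
      (H x).map (mfderiv (𝓡 n) (𝓡 n) φ x).toLinearMap =
        Submodule.span ℝ
          {v : EuclideanSpace ℝ (Fin n) | ∃ i : Fin n, (i : ℕ) < p ∧ v = EuclideanSpace.single i 1}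

/-- `H` is an integrable sub-bundle of rank `p` of the tangent bundle of the `n`-manifold `M`
(equivalently, a foliation of `M` with leaves of dimension `p`): foliation charts exist around
every point. -/
structure IsFoliation (p : ℕ) (H : ∀ x : M, Submodule ℝ (TangentSpace (𝓡 n) x)) : Prop where
  rank_le : p ≤ n
  exists_chart : ∀ x : M, ∃ φ : OpenPartialHomeomorph M (EuclideanSpace ℝ (Fin n)),
    x ∈ φ.source ∧ IsFoliationChart p H φ

end Foliation

/-! ### Multi-indices and partial derivatives -/

/-- The weighted degree `‖α‖ = α₁ + ⋯ + α_p + 2 (α_{p+1} + ⋯ + α_n)` of a multi-index. -/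
def weight {n : ℕ} (p : ℕ) (α : Fin n → ℕ) : ℕ :=
  ∑ i : Fin n, (if (i : ℕ) < p then 1 else 2) * α i

/-- The finite set of multi-indices of weighted degree at most `d`. -/
def multiIndices (n p d : ℕ) : Finset (Fin n → ℕ) :=
  (Fintype.piFinset fun _ : Fin n => Finset.range (d + 1)).filter fun α => weight p α ≤ d

theorem mem_multiIndices {n p d : ℕ} {α : Fin n → ℕ} :
    α ∈ multiIndices n p d ↔ weight p α ≤ d := by
  simp only [multiIndices, Finset.mem_filter, Fintype.mem_piFinset, Finset.mem_range,
    and_iff_right_iff_imp]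
  intro h i
  have h1 : (if (i : ℕ) < p then 1 else 2) * α i ≤ weight p α :=
    Finset.single_le_sum (f := fun i : Fin n => (if (i : ℕ) < p then 1 else 2) * α i)
      (fun _ _ => Nat.zero_le _) (Finset.mem_univ i)
  have h2 : α i ≤ (if (i : ℕ) < p then 1 else 2) * α i := by
    split_ifs <;> omega
  omega

/-- The partial derivative `∂f/∂xᵢ`. -/
def partialDeriv {n : ℕ} {F : Type*} [NormedAddCommGroup F] [NormedSpace ℝ F] (i : Fin n)
    (f : EuclideanSpace ℝ (Fin n) → F) : EuclideanSpace ℝ (Fin n) → F :=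
  fun y => fderiv ℝ f y (EuclideanSpace.single i 1)

/-- The iterated partial derivative `∂^α f = (∂/∂x₁)^{α₁} ⋯ (∂/∂xₙ)^{αₙ} f`. -/
def multiDeriv {n : ℕ} {F : Type*} [NormedAddCommGroup F] [NormedSpace ℝ F] (α : Fin n → ℕ)
    (f : EuclideanSpace ℝ (Fin n) → F) : EuclideanSpace ℝ (Fin n) → F :=
  (List.finRange n).foldr (fun i g => (partialDeriv i)^[α i] g) f

/-! ### Differential operators between sections of complex vector bundles -/

section Operators

variable {n : ℕ} {M : Type*} [TopologicalSpace M] [ChartedSpace (EuclideanSpace ℝ (Fin n)) M]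
  {E : Type*} [NormedAddCommGroup E] [NormedSpace ℂ E]
  {V : M → Type*} [TopologicalSpace (TotalSpace E V)] [∀ x, TopologicalSpace (V x)]
  [∀ x, AddCommGroup (V x)] [∀ x, Module ℂ (V x)]
  [FiberBundle E V] [VectorBundle ℝ E V]
  {F : Type*} [NormedAddCommGroup F] [NormedSpace ℂ F]
  {W : M → Type*} [TopologicalSpace (TotalSpace F W)] [∀ x, TopologicalSpace (W x)]
  [∀ x, AddCommGroup (W x)] [∀ x, Module ℂ (W x)]
  [FiberBundle F W] [VectorBundle ℝ F W]

/-- The image under the chart `φ` of the open set over which the chart and the two local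
trivializations are all defined. -/
def localDomain (φ : OpenPartialHomeomorph M (EuclideanSpace ℝ (Fin n)))
    (e : Trivialization E (π E V)) (e' : Trivialization F (π F W)) :
    Set (EuclideanSpace ℝ (Fin n)) :=
  φ.target ∩ φ.symm ⁻¹' (e.baseSet ∩ e'.baseSet)

/-- The vector-valued function on `ℝⁿ` that represents the section `u` in the chart `φ` and the
trivialization `e` (meaningful at the points of `φ.target` that lie over `e.baseSet`). -/
def localSection (φ : OpenPartialHomeomorph M (EuclideanSpace ℝ (Fin n)))
    (e : Trivialization E (π E V)) (u : ∀ x, V x) : EuclideanSpace ℝ (Fin n) → E :=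
  fun y => (e ⟨φ.symm y, u (φ.symm y)⟩).2

/-- In the chart `φ` and the trivializations `e`, `e'`, the operator `P` is
`∑_{‖α‖ ≤ d} a_α(x) ∂^α`, with smooth matrix-valued coefficients `a_α`. -/
structure IsLocalForm (p d : ℕ) (P : Cₛ^∞⟮𝓡 n; E, V⟯ →ₗ[ℝ] Cₛ^∞⟮𝓡 n; F, W⟯)
    (φ : OpenPartialHomeomorph M (EuclideanSpace ℝ (Fin n)))
    (e : Trivialization E (π E V)) (e' : Trivialization F (π F W))
    (a : (Fin n → ℕ) → EuclideanSpace ℝ (Fin n) → E →L[ℂ] F) : Prop where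
  smooth : ∀ α ∈ multiIndices n p d, ContDiffOn ℝ ∞ (a α) (localDomain φ e e')
  eq_sum : ∀ u : Cₛ^∞⟮𝓡 n; E, V⟯, ∀ y ∈ localDomain φ e e',
    localSection φ e' (P u) y =
      ∑ α ∈ multiIndices n p d, a α y (multiDeriv α (localSection φ e u) y)

/-- `P` is a differential operator of weighted order at most `d` on the foliated manifold. Complex
linearity of `P` is a consequence of the local form. -/
def IsWeightedDiffOp (p : ℕ) (H : ∀ x : M, Submodule ℝ (TangentSpace (𝓡 n) x)) (d : ℕ)
    (P : Cₛ^∞⟮𝓡 n; E, V⟯ →ₗ[ℝ] Cₛ^∞⟮𝓡 n; F, W⟯) : Prop :=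
  ∀ (φ : OpenPartialHomeomorph M (EuclideanSpace ℝ (Fin n)))
    (e : Trivialization E (π E V)) (e' : Trivialization F (π F W)),
    IsFoliationChart p H φ → MemTrivializationAtlas e → MemTrivializationAtlas e' →
      ∃ a : (Fin n → ℕ) → EuclideanSpace ℝ (Fin n) → E →L[ℂ] F, IsLocalForm p d P φ e e' a

/-- The weighted symbol `∑_{‖α‖ = d} a_α(y) (iξ)^α` at `(y, ξ)` of an operator with local
coefficients `a`. -/
def localSymbol (p d : ℕ) (a : (Fin n → ℕ) → EuclideanSpace ℝ (Fin n) → E →L[ℂ] F)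
    (y ξ : EuclideanSpace ℝ (Fin n)) : E →L[ℂ] F :=
  ∑ α ∈ (multiIndices n p d).filter (fun α => weight p α = d),
    (∏ j, (Complex.I * (ξ j : ℂ)) ^ α j) • a α y

/-- The weighted principal symbol `σ_H(P)(x, ξ)` of the operator `P`, of weighted order (at most)
`d`, is invertible at all points `x` and all `ξ ≠ 0`. The local coefficients of `P` in given
coordinates are uniquely determined. -/
def HasInvertibleWeightedSymbol (p : ℕ) (H : ∀ x : M, Submodule ℝ (TangentSpace (𝓡 n) x)) (d : ℕ)
    (P : Cₛ^∞⟮𝓡 n; E, V⟯ →ₗ[ℝ] Cₛ^∞⟮𝓡 n; F, W⟯) : Prop :=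
  ∀ (φ : OpenPartialHomeomorph M (EuclideanSpace ℝ (Fin n)))
    (e : Trivialization E (π E V)) (e' : Trivialization F (π F W)),
    IsFoliationChart p H φ → MemTrivializationAtlas e → MemTrivializationAtlas e' →
      ∀ a : (Fin n → ℕ) → EuclideanSpace ℝ (Fin n) → E →L[ℂ] F, IsLocalForm p d P φ e e' a →
        ∀ y ∈ localDomain φ e e', ∀ ξ : EuclideanSpace ℝ (Fin n), ξ ≠ 0 →
          (localSymbol p d a y ξ).IsInvertible

end Operators

/-! ### `L²` norms -/

section Norms

variable {n : ℕ} {M : Type*} [TopologicalSpace M] [ChartedSpace (EuclideanSpace ℝ (Fin n)) M]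

/-- `μ` is given by a smooth positive density: in every smooth chart it is a smooth positive
function times Lebesgue measure. -/
def IsSmoothPositiveDensity (n : ℕ) {M : Type*} [TopologicalSpace M]
    [ChartedSpace (EuclideanSpace ℝ (Fin n)) M] [MeasurableSpace M] (μ : Measure M) : Prop :=
  ∀ φ ∈ IsManifold.maximalAtlas (𝓡 n) ∞ M,
    ∃ ρ : EuclideanSpace ℝ (Fin n) → ℝ, ContDiffOn ℝ ∞ ρ φ.target ∧ (∀ y ∈ φ.target, 0 < ρ y) ∧
      (μ.restrict φ.source).map φ =
        (volume.restrict φ.target).withDensity fun y => ENNReal.ofReal (ρ y)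

/-- A smooth Hermitian metric on a complex vector bundle (conjugate linear in the first
variable). -/
structure HermitianMetric (n : ℕ) {M : Type*} [TopologicalSpace M]
    [ChartedSpace (EuclideanSpace ℝ (Fin n)) M]
    (E : Type*) [NormedAddCommGroup E] [NormedSpace ℂ E]
    (V : M → Type*) [TopologicalSpace (TotalSpace E V)] [∀ x, TopologicalSpace (V x)]
    [∀ x, AddCommGroup (V x)] [∀ x, Module ℂ (V x)] [FiberBundle E V] where
  /-- the Hermitian form on each fibre -/
  form : ∀ x, V x →ₗ⋆[ℂ] V x →ₗ[ℂ] ℂ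
  conj_symm : ∀ x (v w : V x), starRingEnd ℂ (form x v w) = form x w v
  pos : ∀ x (v : V x), v ≠ 0 → 0 < (form x v v).re
  smooth : ∀ s t : Cₛ^∞⟮𝓡 n; E, V⟯,
    ContMDiff (𝓡 n) 𝓘(ℝ, ℂ) ∞ fun x => form x (s x) (t x)

/-- The norm `(∫_M |u(x)|² dμ(x))^{1/2}` in `L²(M)` of a smooth section. -/
def l2Norm {E : Type*} [NormedAddCommGroup E] [NormedSpace ℂ E]
    {V : M → Type*} [TopologicalSpace (TotalSpace E V)] [∀ x, TopologicalSpace (V x)]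
    [∀ x, AddCommGroup (V x)] [∀ x, Module ℂ (V x)] [FiberBundle E V]
    [MeasurableSpace M] (μ : Measure M) (h : HermitianMetric n E V)
    (u : Cₛ^∞⟮𝓡 n; E, V⟯) : ℝ :=
  Real.sqrt (∫ x, (h.form x (u x) (u x)).re ∂μ)

end Norms

end WeightedCalculus

end

/-!
The estimate is proved locally and without a parametrix; nothing is ever transported from one chart
to another. Since `‖P u‖` and `‖u‖` are global quantities, compactness of `M` reduces the theorem to
the claim that every point has a neighbourhood `U` with
`∫_U |A u|² ≤ C (∫_M |P u|² + ∫_M |u|²)` (`exists_local_estimate`). In a foliation chart and in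
local trivializations the densities and the metrics are comparable to the standard ones, and the
claim becomes an interior estimate for a system on an open subset of `ℝⁿ`
(`exists_interior_estimate`): all derivatives `∂^α v` with `‖α‖ ≤ d` are bounded in `L²` on a small
ball by `P v` and `v` on a larger one.

The interior estimate rests on three facts.

* For constant coefficients and compact support, Plancherel's theorem turns the claim into a bound
  of the monomials `ξ^α`, `‖α‖ = d`, by the symbol
  (`exists_prod_mul_norm_le_norm_constSymbol`). Both sides are homogeneous for the anisotropic
  dilations, so compactness of the set where the gauge equals one suffices.
* For a cut-off `χ`, let `mass k` be the sum of the squared `L²` norms of `χ^k ∂_w v` over the words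
  `w` of weight `k`. The power of `χ` equals the weight, which makes these quantities closed under
  interpolation: an integration by parts bounds an intermediate one by a small multiple of the
  higher and a large multiple of the lower ones (`exists_integral_partialDeriv_sq_le`), so that
  `∑_{k < d} mass k ≤ ε mass d + C ∫ |v|²` (`exists_sum_mass_le`).
* The commutator of a derivative of weight `d` with `χ^d` only produces terms that are controlled by
  `mass k` with `k < d` (`exists_norm_wordDeriv_smul_sub_le`).

Freezing the coefficients at the centre of a ball on which they oscillate little, the estimate for
constant coefficients applied to `χ^d v` bounds `mass d` by `P v`, a small multiple of `mass d` and
a large multiple of `∑_{k < d} mass k` (`exists_mass_top_le`); interpolation absorbs the last two.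

Interpolation fails when `d` is odd and some direction has weight two, since a derivative of weight
`d - 1` in these directions lies below no derivative of weight `d`. In this case the symbol
vanishes in such a direction, and its invertibility forces the fibres to be trivial
(`exists_letter_or_subsingleton`).
-/

noncomputable section

namespace WeightedCalculus

/-! ### Iterated partial derivatives indexed by words -/

section Words

variable {n : ℕ} {E : Type*} [NormedAddCommGroup E] [NormedSpace ℝ E]

/-- The iterated partial derivative `∂_{i₁} ⋯ ∂_{i_k} f` along the word `i₁ ⋯ i_k`. Words, unlike
multi-indices, allow a derivative to be put in front or at the end without reordering. -/
def wordDeriv (w : List (Fin n)) (f : EuclideanSpace ℝ (Fin n) → E) :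
    EuclideanSpace ℝ (Fin n) → E :=
  w.foldr partialDeriv f

/-- The weight of the coordinate direction `i`: one along the leaves, two across them. -/
def letterWeight (p : ℕ) (i : Fin n) : ℕ := if (i : ℕ) < p then 1 else 2

/-- The weighted length of a word. -/
def wordWeight (p : ℕ) (w : List (Fin n)) : ℕ := (w.map (letterWeight p)).sum

/-- The word `1 ⋯ 1 2 ⋯ 2 ⋯ n ⋯ n` in which the letter `i` occurs `αᵢ` times. -/
def wordOf (α : Fin n → ℕ) : List (Fin n) :=
  (List.finRange n).flatMap fun i => List.replicate (α i) i

@[simp] theorem wordDeriv_nil (f : EuclideanSpace ℝ (Fin n) → E) : wordDeriv [] f = f := rfl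

@[simp] theorem wordDeriv_cons (i : Fin n) (w : List (Fin n))
    (f : EuclideanSpace ℝ (Fin n) → E) :
    wordDeriv (i :: w) f = partialDeriv i (wordDeriv w f) := rfl

theorem wordDeriv_append (w w' : List (Fin n)) (f : EuclideanSpace ℝ (Fin n) → E) :
    wordDeriv (w ++ w') f = wordDeriv w (wordDeriv w' f) := by
  simp [wordDeriv]

theorem one_le_letterWeight (p : ℕ) (i : Fin n) : 1 ≤ letterWeight p i := by
  unfold letterWeight; split_ifs <;> omega

theorem letterWeight_le_two (p : ℕ) (i : Fin n) : letterWeight p i ≤ 2 := by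
  unfold letterWeight; split_ifs <;> omega

@[simp] theorem wordWeight_nil (p : ℕ) : wordWeight p ([] : List (Fin n)) = 0 := rfl

@[simp] theorem wordWeight_cons (p : ℕ) (i : Fin n) (w : List (Fin n)) :
    wordWeight p (i :: w) = letterWeight p i + wordWeight p w := by simp [wordWeight]

theorem wordWeight_append (p : ℕ) (w w' : List (Fin n)) :
    wordWeight p (w ++ w') = wordWeight p w + wordWeight p w' := by simp [wordWeight]

theorem wordWeight_perm (p : ℕ) {w w' : List (Fin n)} (h : w.Perm w') :
    wordWeight p w = wordWeight p w' := (h.map _).sum_eq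

theorem length_le_wordWeight (p : ℕ) (w : List (Fin n)) : w.length ≤ wordWeight p w := by
  induction w with
  | nil => simp
  | cons i w ih => have := one_le_letterWeight p i; simp; omega

theorem finite_setOf_wordWeight_eq (n p k : ℕ) :
    {w : List (Fin n) | wordWeight p w = k}.Finite :=
  (List.finite_length_le (Fin n) k).subset fun w hw => hw ▸ length_le_wordWeight p w

/-- The finite set of words of weight `k`. -/
def words (n p k : ℕ) : Finset (List (Fin n)) := (finite_setOf_wordWeight_eq n p k).toFinset

@[simp] theorem mem_words {n p k : ℕ} {w : List (Fin n)} :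
    w ∈ words n p k ↔ wordWeight p w = k := by simp [words]

theorem words_zero (n p : ℕ) : words n p 0 = {[]} := by
  ext w
  rw [mem_words, Finset.mem_singleton]
  refine ⟨fun h => ?_, fun h => by simp [h]⟩
  have := length_le_wordWeight p w
  exact List.length_eq_zero_iff.1 (by omega)

theorem wordDeriv_replicate (m : ℕ) (i : Fin n) (f : EuclideanSpace ℝ (Fin n) → E) :
    wordDeriv (List.replicate m i) f = (partialDeriv i)^[m] f := by
  induction m with
  | zero => rfl
  | succ m ih => rw [List.replicate_succ, wordDeriv_cons, ih, Function.iterate_succ_apply']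

theorem multiDeriv_eq_wordDeriv (α : Fin n → ℕ) (f : EuclideanSpace ℝ (Fin n) → E) :
    multiDeriv α f = wordDeriv (wordOf α) f := by
  unfold multiDeriv wordOf
  induction List.finRange n with
  | nil => rfl
  | cons i l ih => rw [List.foldr_cons, List.flatMap_cons, wordDeriv_append, ← ih,
      wordDeriv_replicate]

theorem prod_map_wordOf {R : Type*} [CommMonoid R] (α : Fin n → ℕ) (c : Fin n → R) :
    ((wordOf α).map c).prod = ∏ j, c j ^ α j := by
  have : ∀ l : List (Fin n), ((l.flatMap fun i => List.replicate (α i) i).map c).prod =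
      (l.map fun j => c j ^ α j).prod := by
    intro l
    induction l with
    | nil => rfl
    | cons i l ih => simp [List.flatMap_cons, ih]
  rw [wordOf, this, ← List.ofFn_eq_map, List.prod_ofFn]

theorem wordWeight_wordOf (p : ℕ) (α : Fin n → ℕ) : wordWeight p (wordOf α) = weight p α := by
  have : ∀ l : List (Fin n),
      ((l.flatMap fun i => List.replicate (α i) i).map (letterWeight p)).sum =
      (l.map fun j => letterWeight p j * α j).sum := by
    intro l
    induction l with
    | nil => rfl
    | cons i l ih => simp [List.flatMap_cons, ih, mul_comm]
  rw [wordWeight, wordOf, this, ← List.ofFn_eq_map, List.sum_ofFn]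
  rfl

theorem contDiff_partialDeriv (i : Fin n) {f : EuclideanSpace ℝ (Fin n) → E}
    (hf : ContDiff ℝ ∞ f) : ContDiff ℝ ∞ (partialDeriv i f) :=
  (hf.fderiv_right (m := ∞) (by simp)).clm_apply contDiff_const

theorem contDiff_wordDeriv (w : List (Fin n)) {f : EuclideanSpace ℝ (Fin n) → E}
    (hf : ContDiff ℝ ∞ f) : ContDiff ℝ ∞ (wordDeriv w f) := by
  induction w with
  | nil => exact hf
  | cons i w ih => exact contDiff_partialDeriv i ih

theorem partialDeriv_comm (i j : Fin n) {f : EuclideanSpace ℝ (Fin n) → E}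
    (hf : ContDiff ℝ ∞ f) :
    partialDeriv i (partialDeriv j f) = partialDeriv j (partialDeriv i f) := by
  have key : ∀ (a b : EuclideanSpace ℝ (Fin n)) y,
      fderiv ℝ (fun z => fderiv ℝ f z b) y a = fderiv ℝ (fderiv ℝ f) y a b := by
    intro a b y
    have hd : DifferentiableAt ℝ (fderiv ℝ f) y :=
      (hf.fderiv_right (m := ∞) (by simp)).differentiable (by simp) y
    rw [fderiv_clm_apply hd (differentiableAt_const b)]
    simp
  funext y
  refine (key _ _ y).trans (Eq.trans ?_ (key _ _ y).symm)
  exact (hf.contDiffAt.isSymmSndFDerivAt (by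
    rw [minSmoothness_of_isRCLikeNormedField]
    exact WithTop.coe_le_coe.2 (le_top : (2 : ℕ∞) ≤ ⊤))) _ _

theorem wordDeriv_perm {w w' : List (Fin n)} (h : w.Perm w')
    {f : EuclideanSpace ℝ (Fin n) → E} (hf : ContDiff ℝ ∞ f) :
    wordDeriv w f = wordDeriv w' f := by
  induction h with
  | nil => rfl
  | cons i _ ih => rw [wordDeriv_cons, wordDeriv_cons, ih]
  | swap i j l => exact partialDeriv_comm _ _ (contDiff_wordDeriv l hf)
  | trans _ _ ih₁ ih₂ => exact ih₁.trans ih₂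

theorem partialDeriv_congr_of_eventuallyEq (i : Fin n) {f g : EuclideanSpace ℝ (Fin n) → E}
    {y : EuclideanSpace ℝ (Fin n)} (h : f =ᶠ[nhds y] g) :
    partialDeriv i f =ᶠ[nhds y] partialDeriv i g := by
  filter_upwards [h.fderiv (𝕜 := ℝ)] with z hz
  simp [partialDeriv, hz]

theorem wordDeriv_congr_of_eventuallyEq (w : List (Fin n))
    {f g : EuclideanSpace ℝ (Fin n) → E} {y : EuclideanSpace ℝ (Fin n)} (h : f =ᶠ[nhds y] g) :
    wordDeriv w f =ᶠ[nhds y] wordDeriv w g := by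
  induction w with
  | nil => exact h
  | cons i w ih => exact partialDeriv_congr_of_eventuallyEq i ih

theorem wordDeriv_add (w : List (Fin n)) {f g : EuclideanSpace ℝ (Fin n) → E}
    (hf : ContDiff ℝ ∞ f) (hg : ContDiff ℝ ∞ g) :
    wordDeriv w (f + g) = wordDeriv w f + wordDeriv w g := by
  induction w with
  | nil => rfl
  | cons i w ih =>
    funext y
    rw [wordDeriv_cons, ih, partialDeriv,
      fderiv_add ((contDiff_wordDeriv w hf).differentiable (by simp) y)
        ((contDiff_wordDeriv w hg).differentiable (by simp) y)]
    rfl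

theorem wordDeriv_clm_comp {F : Type*} [NormedAddCommGroup F] [NormedSpace ℝ F]
    (L : E →L[ℝ] F) (w : List (Fin n)) {f : EuclideanSpace ℝ (Fin n) → E}
    (hf : ContDiff ℝ ∞ f) : wordDeriv w (fun y => L (f y)) = fun y => L (wordDeriv w f y) := by
  induction w with
  | nil => rfl
  | cons i w ih =>
    funext y
    rw [wordDeriv_cons, ih, partialDeriv]
    have := (L.hasFDerivAt (x := wordDeriv w f y)).comp y
      ((contDiff_wordDeriv w hf).differentiable (by simp) y).hasFDerivAt
    erw [this.fderiv]
    rfl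

theorem partialDeriv_smul (i : Fin n) {c : EuclideanSpace ℝ (Fin n) → ℝ}
    {f : EuclideanSpace ℝ (Fin n) → E} (hc : ContDiff ℝ ∞ c) (hf : ContDiff ℝ ∞ f) :
    partialDeriv i (fun y => c y • f y) =
      (fun y => partialDeriv i c y • f y) + fun y => c y • partialDeriv i f y := by
  funext y
  simp only [partialDeriv, Pi.add_apply]
  rw [fderiv_fun_smul (hc.differentiable (by simp) y) (hf.differentiable (by simp) y)]
  simp [add_comm]

theorem tsupport_partialDeriv_subset (i : Fin n) (f : EuclideanSpace ℝ (Fin n) → E) :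
    tsupport (partialDeriv i f) ⊆ tsupport f := by
  refine (closure_mono fun y hy => ?_).trans (tsupport_fderiv_subset ℝ (f := f))
  rw [Function.mem_support] at hy ⊢
  exact fun hy' => hy (by simp [partialDeriv, hy'])

theorem tsupport_wordDeriv_subset (w : List (Fin n)) (f : EuclideanSpace ℝ (Fin n) → E) :
    tsupport (wordDeriv w f) ⊆ tsupport f := by
  induction w with
  | nil => exact subset_rfl
  | cons i w ih => exact (tsupport_partialDeriv_subset i _).trans ih

end Words

/-! ### Constant coefficients: the Fourier transform -/

section Fourier

open FourierTransform
open scoped SchwartzMap LineDeriv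

variable {n : ℕ}

section Symbol

variable {E : Type*} [NormedAddCommGroup E] [NormedSpace ℂ E]
  {F : Type*} [NormedAddCommGroup F] [NormedSpace ℂ F]

/-- The symbol `∑_{‖α‖ = d} (iη)^α b_α` of an operator with constant coefficients. -/
def constSymbol (p d : ℕ) (b : (Fin n → ℕ) → E →L[ℂ] F) (η : Fin n → ℝ) : E →L[ℂ] F :=
  ∑ α ∈ (multiIndices n p d).filter (fun α => weight p α = d),
    (∏ j, (Complex.I * (η j : ℂ)) ^ α j) • b α

/-- The anisotropic dilation of `ℝⁿ`. -/
def dilate (p : ℕ) (t : ℝ) (η : Fin n → ℝ) : Fin n → ℝ := fun i => t ^ letterWeight p i * η i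

theorem constSymbol_dilate (p d : ℕ) (b : (Fin n → ℕ) → E →L[ℂ] F) (t : ℝ) (η : Fin n → ℝ) :
    constSymbol p d b (dilate p t η) = (t : ℂ) ^ d • constSymbol p d b η := by
  unfold constSymbol
  rw [Finset.smul_sum]
  refine Finset.sum_congr rfl fun α hα => ?_
  rw [smul_smul]
  congr 1
  rw [← (Finset.mem_filter.1 hα).2, weight, ← Finset.prod_pow_eq_pow_sum, ← Finset.prod_mul_distrib]
  refine Finset.prod_congr rfl fun j _ => ?_
  rw [pow_mul, ← mul_pow]
  congr 1
  simp only [dilate, letterWeight]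
  push_cast
  ring

theorem prod_map_dilate (p : ℕ) (t : ℝ) (η : Fin n → ℝ) (w : List (Fin n)) :
    (w.map (dilate p t η)).prod = t ^ wordWeight p w * (w.map η).prod := by
  induction w with
  | nil => simp
  | cons i w ih => simp [ih, dilate, pow_add]; ring

/-- A function of `η` that is homogeneous of degree `4` for the anisotropic dilations and positive
away from the origin. -/
def gauge (p : ℕ) (η : Fin n → ℝ) : ℝ := ∑ i, (η i) ^ (if (i : ℕ) < p then 4 else 2)

theorem gauge_dilate (p : ℕ) (t : ℝ) (η : Fin n → ℝ) :
    gauge p (dilate p t η) = t ^ 4 * gauge p η := by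
  unfold gauge dilate letterWeight
  rw [Finset.mul_sum]
  refine Finset.sum_congr rfl fun i _ => ?_
  split_ifs <;> ring

theorem gauge_term_nonneg (p : ℕ) (η : Fin n → ℝ) (i : Fin n) :
    0 ≤ (η i) ^ (if (i : ℕ) < p then 4 else 2) := by
  split_ifs <;> positivity

theorem gauge_pos (p : ℕ) {η : Fin n → ℝ} (hη : η ≠ 0) : 0 < gauge p η := by
  obtain ⟨i, hi⟩ := Function.ne_iff.1 hη
  refine Finset.sum_pos' (fun i _ => gauge_term_nonneg p η i) ⟨i, Finset.mem_univ i, ?_⟩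
  have : η i ≠ 0 := hi
  split_ifs <;> positivity

theorem abs_le_one_of_gauge_eq_one {p : ℕ} {η : Fin n → ℝ} (h : gauge p η = 1) (i : Fin n) :
    |η i| ≤ 1 := by
  have h1 : (η i) ^ (if (i : ℕ) < p then 4 else 2) ≤ 1 := h ▸
    Finset.single_le_sum (f := fun i : Fin n => (η i) ^ (if (i : ℕ) < p then 4 else 2))
      (fun i _ => gauge_term_nonneg p η i) (Finset.mem_univ i)
  have h2 : |η i| ^ (if (i : ℕ) < p then 4 else 2) ≤ 1 := by
    rw [← abs_pow, abs_of_nonneg (gauge_term_nonneg p η i)]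
    exact h1
  exact (pow_le_one_iff_of_nonneg (abs_nonneg _) (by split_ifs <;> norm_num)).1 h2

theorem isCompact_gauge_eq_one (n p : ℕ) : IsCompact {η : Fin n → ℝ | gauge p η = 1} := by
  have hbox := isCompact_univ_pi fun _ : Fin n => isCompact_Icc (a := (-1 : ℝ)) (b := 1)
  refine hbox.of_isClosed_subset
    (isClosed_eq (by unfold gauge; fun_prop) continuous_const) fun η hη i _ => ?_
  exact abs_le.1 (abs_le_one_of_gauge_eq_one hη i)

theorem abs_prod_map_le_one {p : ℕ} {η : Fin n → ℝ} (h : gauge p η = 1) (w : List (Fin n)) :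
    |(w.map η).prod| ≤ 1 := by
  induction w with
  | nil => simp
  | cons i w ih =>
    rw [List.map_cons, List.prod_cons, abs_mul]
    exact mul_le_one₀ (abs_le_one_of_gauge_eq_one h i) (abs_nonneg _) ih

/-- An invertible anisotropically homogeneous symbol dominates every monomial of its degree: by
homogeneity it suffices to look at the compact set where the gauge equals one. -/
theorem exists_prod_mul_norm_le_norm_constSymbol [FiniteDimensional ℂ E] {p d : ℕ} (hd : 1 ≤ d)
    {b : (Fin n → ℕ) → E →L[ℂ] F}
    (hb : ∀ η : Fin n → ℝ, η ≠ 0 → (constSymbol p d b η).IsInvertible) :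
    ∃ C : ℝ, 0 ≤ C ∧ ∀ w : List (Fin n), wordWeight p w = d → ∀ (η : Fin n → ℝ) (z : E),
      |(w.map η).prod| * ‖z‖ ≤ C * ‖constSymbol p d b η z‖ := by
  have : ProperSpace E := FiniteDimensional.proper ℂ E
  obtain ⟨c, hc, hcb⟩ : ∃ c : ℝ, 0 < c ∧ ∀ q ∈ {η : Fin n → ℝ | gauge p η = 1} ×ˢ
      Metric.sphere (0 : E) 1, c ≤ ‖constSymbol p d b q.1 q.2‖ := by
    refine ((isCompact_gauge_eq_one n p).prod (isCompact_sphere 0 1)).exists_forall_le'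
      (Continuous.continuousOn ?_) ?_
    · unfold constSymbol
      simp only [_root_.sum_apply, _root_.smul_apply]
      fun_prop
    · rintro ⟨η, z⟩ ⟨hη, hz⟩
      have hη' : η ≠ 0 := by
        rintro rfl
        have : gauge p (0 : Fin n → ℝ) = 0 :=
          Finset.sum_eq_zero fun i _ => by simp
        simp only [Set.mem_ofPred_eq, this] at hη
        norm_num at hη
      obtain ⟨e, he⟩ := hb η hη'
      rw [norm_pos_iff, ← he]
      simp only [ContinuousLinearEquiv.coe_coe, ne_eq, EmbeddingLike.map_eq_zero_iff]
      rintro rfl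
      simp at hz
  refine ⟨c⁻¹, by positivity, fun w hw η z => ?_⟩
  rcases eq_or_ne η 0 with rfl | hη
  · -- the word is not empty because its weight is positive
    rcases w with _ | ⟨i, w⟩
    · simp at hw; omega
    · simp only [List.map_cons, Pi.zero_apply, List.prod_cons, zero_mul, abs_zero]
      positivity
  rcases eq_or_ne z 0 with rfl | hz
  · simp
  set q := gauge p η with hq
  have hq0 : 0 < q := gauge_pos p hη
  set t := q ^ (-(1 / 4 : ℝ)) with ht
  have ht0 : 0 < t := Real.rpow_pos_of_pos hq0 _
  have ht4 : t ^ 4 * q = 1 := by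
    rw [ht, ← Real.rpow_natCast, ← Real.rpow_mul hq0.le]
    norm_num
    rw [Real.rpow_neg_one, inv_mul_cancel₀ hq0.ne']
  have hg : gauge p (dilate p t η) = 1 := by rw [gauge_dilate, ht4]
  have hz0 : 0 < ‖z‖ := norm_pos_iff.2 hz
  have h1 := hcb (dilate p t η, ((‖z‖⁻¹ : ℝ) : ℂ) • z) ⟨hg, by
    simp [norm_smul, inv_mul_cancel₀ hz0.ne']⟩
  have h2 := abs_prod_map_le_one hg w
  rw [prod_map_dilate, hw, abs_mul, abs_of_pos (pow_pos ht0 d)] at h2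
  simp only [constSymbol_dilate, map_smul, _root_.smul_apply, norm_smul,
    norm_pow, Complex.norm_real, Real.norm_eq_abs, abs_of_pos ht0, abs_inv, abs_norm] at h1
  rw [inv_mul_eq_div, le_div_iff₀ hc]
  have h3 : 0 < t ^ d := pow_pos ht0 d
  have h4 : c * ‖z‖ ≤ t ^ d * ‖constSymbol p d b η z‖ := by
    rw [← le_div_iff₀ hz0]
    refine h1.trans (le_of_eq ?_)
    field_simp
  refine le_of_mul_le_mul_left ?_ h3
  calc t ^ d * (|(w.map η).prod| * ‖z‖ * c) = (t ^ d * |(w.map η).prod|) * (c * ‖z‖) := by ring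
    _ ≤ 1 * (c * ‖z‖) := by gcongr
    _ ≤ _ := by rw [one_mul]; exact h4

end Symbol

variable {E : Type*} [NormedAddCommGroup E] [InnerProductSpace ℂ E]
  {F : Type*} [NormedAddCommGroup F] [InnerProductSpace ℂ F]

/-- The iterated derivative of a Schwartz function along a word, as a Schwartz function. -/
def schwartzWordDeriv (w : List (Fin n)) (f : 𝓢(EuclideanSpace ℝ (Fin n), E)) :
    𝓢(EuclideanSpace ℝ (Fin n), E) :=
  w.foldr (fun i g => ∂_{(EuclideanSpace.single i 1 : EuclideanSpace ℝ (Fin n))} g) f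

theorem coe_schwartzWordDeriv (w : List (Fin n)) (f : 𝓢(EuclideanSpace ℝ (Fin n), E)) :
    ⇑(schwartzWordDeriv w f) = wordDeriv w f := by
  induction w with
  | nil => rfl
  | cons i w ih => rw [wordDeriv_cons, ← ih]; rfl

theorem fourier_schwartzWordDeriv (w : List (Fin n)) (f : 𝓢(EuclideanSpace ℝ (Fin n), E))
    (ξ : EuclideanSpace ℝ (Fin n)) :
    𝓕 (schwartzWordDeriv w f) ξ =
      (w.map fun i => Complex.I * ((2 * Real.pi * ξ i : ℝ) : ℂ)).prod • 𝓕 f ξ := by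
  induction w with
  | nil => simp [schwartzWordDeriv]
  | cons i w ih =>
    have : (fun y : EuclideanSpace ℝ (Fin n) =>
        inner ℝ y (EuclideanSpace.single i 1)).HasTemperateGrowth :=
      ((innerSL ℝ).flip (EuclideanSpace.single i 1)).hasTemperateGrowth
    have h : schwartzWordDeriv (i :: w) f =
      ∂_{(EuclideanSpace.single i 1 : EuclideanSpace ℝ (Fin n))} (schwartzWordDeriv w f) := rfl
    rw [h, SchwartzMap.fourier_lineDerivOp_eq, _root_.smul_apply,
      SchwartzMap.smulLeftCLM_apply_apply this, ih, ← Complex.coe_smul, smul_smul, smul_smul]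
    congr 1
    rw [EuclideanSpace.inner_single_right]
    simp only [List.map_cons, List.prod_cons, conj_trivial, one_mul]
    push_cast
    ring

theorem fourier_sum_clm_comp [CompleteSpace E] [CompleteSpace F] {ι : Type*} (s : Finset ι)
    (b : ι → E →L[ℂ] F) (f : ι → 𝓢(EuclideanSpace ℝ (Fin n), E)) (ξ : EuclideanSpace ℝ (Fin n)) :
    𝓕 (fun y => ∑ α ∈ s, b α (f α y)) ξ = ∑ α ∈ s, b α (𝓕 (f α) ξ) := by
  have hint : ∀ α, Integrable fun y => Real.fourierChar (-inner ℝ y ξ) • f α y := fun α =>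
    (Real.fourierIntegral_convergent_iff ξ).2 (f α).integrable
  simp only [SchwartzMap.fourier_coe, Real.fourier_eq]
  simp_rw [← ContinuousLinearMap.integral_comp_comm _ (hint _)]
  rw [← integral_finsetSum]
  · refine integral_congr_ae (Filter.Eventually.of_forall fun y => ?_)
    simp [Circle.smul_def, Finset.smul_sum]
  · exact fun α _ => (b α).integrable_comp (hint α)

theorem integrable_norm_sq_schwartz {H : Type*} [NormedAddCommGroup H] [NormedSpace ℝ H]
    (g : 𝓢(EuclideanSpace ℝ (Fin n), H)) : Integrable fun ξ => ‖g ξ‖ ^ 2 :=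
  (memLp_two_iff_integrable_sq_norm g.continuous.aestronglyMeasurable).1 (g.memLp 2 volume)

theorem norm_prod_map_mul_I (η : Fin n → ℝ) (w : List (Fin n)) :
    ‖(w.map fun i => Complex.I * ((η i : ℝ) : ℂ)).prod‖ = |(w.map η).prod| := by
  induction w with
  | nil => simp
  | cons i w ih =>
    rw [List.map_cons, List.prod_cons, norm_mul, ih]
    simp [abs_mul]

/-- The elliptic estimate for constant coefficients, by Plancherel's theorem. -/
theorem exists_integral_norm_wordDeriv_sq_le [FiniteDimensional ℂ E] [FiniteDimensional ℂ F]
    {p d : ℕ} (hd : 1 ≤ d) {b : (Fin n → ℕ) → E →L[ℂ] F}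
    (hb : ∀ η : Fin n → ℝ, η ≠ 0 → (constSymbol p d b η).IsInvertible) :
    ∃ C : ℝ, 0 ≤ C ∧ ∀ w : List (Fin n), wordWeight p w = d →
      ∀ f : EuclideanSpace ℝ (Fin n) → E, ContDiff ℝ ∞ f → HasCompactSupport f →
        ∫ y, ‖wordDeriv w f y‖ ^ 2 ≤ C * ∫ y,
          ‖∑ α ∈ (multiIndices n p d).filter (fun α => weight p α = d),
            b α (wordDeriv (wordOf α) f y)‖ ^ 2 := by
  have : CompleteSpace E := FiniteDimensional.complete ℂ E
  have : CompleteSpace F := FiniteDimensional.complete ℂ F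
  obtain ⟨C, hC, hCb⟩ := exists_prod_mul_norm_le_norm_constSymbol hd hb
  refine ⟨C ^ 2, by positivity, fun w hw f hf hfs => ?_⟩
  set S := (multiIndices n p d).filter (fun α => weight p α = d) with hS
  set φ : 𝓢(EuclideanSpace ℝ (Fin n), E) := hfs.toSchwartzMap hf with hφ
  have hφf : ⇑φ = f := rfl
  set G : EuclideanSpace ℝ (Fin n) → F := fun y => ∑ α ∈ S, b α (wordDeriv (wordOf α) f y) with hG
  have hGs : ContDiff ℝ ∞ G := by
    refine ContDiff.sum fun α _ => ?_
    exact ((b α).restrictScalars ℝ).contDiff.comp (contDiff_wordDeriv _ hf)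
  have hGc : HasCompactSupport G := by
    refine HasCompactSupport.intro hfs fun y hy => ?_
    refine Finset.sum_eq_zero fun α _ => ?_
    rw [image_eq_zero_of_notMem_tsupport fun h => hy (tsupport_wordDeriv_subset _ f h), map_zero]
  set γ : 𝓢(EuclideanSpace ℝ (Fin n), F) := hGc.toSchwartzMap hGs with hγ
  have h1 : ∫ y, ‖wordDeriv w f y‖ ^ 2 = ∫ ξ, ‖𝓕 (schwartzWordDeriv w φ) ξ‖ ^ 2 := by
    rw [SchwartzMap.integral_norm_sq_fourier, coe_schwartzWordDeriv, hφf]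
  have h2 : ∫ y, ‖G y‖ ^ 2 = ∫ ξ, ‖𝓕 γ ξ‖ ^ 2 := by
    rw [SchwartzMap.integral_norm_sq_fourier]; rfl
  have h3 : ∀ ξ : EuclideanSpace ℝ (Fin n), 𝓕 γ ξ =
      constSymbol p d b (fun i => 2 * Real.pi * ξ i) (𝓕 φ ξ) := by
    intro ξ
    have hγG : ⇑γ = fun y => ∑ α ∈ S, b α (schwartzWordDeriv (wordOf α) φ y) := by
      simp only [coe_schwartzWordDeriv, hφf]
      rfl
    rw [SchwartzMap.fourier_coe, hγG, fourier_sum_clm_comp, constSymbol, _root_.sum_apply]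
    refine Finset.sum_congr rfl fun α _ => ?_
    rw [fourier_schwartzWordDeriv, map_smul, _root_.smul_apply,
      prod_map_wordOf α fun i => Complex.I * ((2 * Real.pi * ξ i : ℝ) : ℂ)]
  rw [h1, h2, ← integral_const_mul]
  refine integral_mono (integrable_norm_sq_schwartz _)
    ((integrable_norm_sq_schwartz _).const_mul _) fun ξ => ?_
  rw [← mul_pow, h3, fourier_schwartzWordDeriv, norm_smul, norm_prod_map_mul_I]
  exact pow_le_pow_left₀ (by positivity) (hCb w hw _ (𝓕 φ ξ)) 2

end Fourier

/-! ### Localized norms and interpolation -/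

section Interpolation

variable {n : ℕ}

/-- `χ` is a smooth cut-off function with values in `[0, 1]`, supported in the compact set `K`. -/
structure IsCutoff (χ : EuclideanSpace ℝ (Fin n) → ℝ) (K : Set (EuclideanSpace ℝ (Fin n))) :
    Prop where
  smooth : ContDiff ℝ ∞ χ
  nonneg : ∀ y, 0 ≤ χ y
  le_one : ∀ y, χ y ≤ 1
  isCompact : IsCompact K
  tsupport_subset : tsupport χ ⊆ K

theorem integral_partialDeriv_eq_zero {g : EuclideanSpace ℝ (Fin n) → ℝ} (hg : ContDiff ℝ ∞ g)
    (hc : HasCompactSupport g) (i : Fin n) : ∫ y, partialDeriv i g y = 0 := by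
  have hint : Integrable g := hg.continuous.integrable_of_hasCompactSupport hc
  have hint' : Integrable (partialDeriv i g) :=
    (contDiff_partialDeriv i hg).continuous.integrable_of_hasCompactSupport
      (hc.mono' ((subset_tsupport _).trans (tsupport_partialDeriv_subset i g)))
  have := integral_mul_fderiv_eq_neg_fderiv_mul_of_integrable (μ := volume)
    (f := fun _ : EuclideanSpace ℝ (Fin n) => (1 : ℝ)) (g := g)
    (v := EuclideanSpace.single i 1) (by simp) (by simpa using! hint') (by simpa using hint)
    (fun x _ => differentiableAt_const _) (fun x _ => hg.differentiable (by simp) x)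
  simpa using! this

/-- Interpolation in one direction: integrate `∂ᵢ(χ^{2k} ⟪∂ᵢv, v⟫)` and use Young's inequality. The
exponents of the cut-off match the weights, so that the same cut-off serves on both sides. -/
theorem exists_integral_partialDeriv_sq_le {E : Type*} [NormedAddCommGroup E]
    [InnerProductSpace ℝ E] {χ : EuclideanSpace ℝ (Fin n) → ℝ}
    {K : Set (EuclideanSpace ℝ (Fin n))} (hχ : IsCutoff χ K) (i : Fin n) {k m : ℕ} (hm : 1 ≤ m)
    (hk : m ≤ k) {ε : ℝ} (hε : 0 < ε) :
    ∃ C : ℝ, 0 ≤ C ∧ ∀ v : EuclideanSpace ℝ (Fin n) → E, ContDiff ℝ ∞ v →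
      ∫ y in K, (χ y ^ k * ‖partialDeriv i v y‖) ^ 2 ≤
        ε * (∫ y in K, (χ y ^ (k + m) * ‖partialDeriv i (partialDeriv i v) y‖) ^ 2) +
        C * ∫ y in K, (χ y ^ (k - m) * ‖v y‖) ^ 2 := by
  obtain ⟨M, hM⟩ := hχ.isCompact.exists_bound_of_continuousOn
    (contDiff_partialDeriv i hχ.smooth).continuous.continuousOn
  refine ⟨4 * k ^ 2 * M ^ 2 + ε⁻¹, by positivity, fun v hv => ?_⟩
  have hv1 := contDiff_partialDeriv i hv
  have hv2 := contDiff_partialDeriv i hv1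
  set g : EuclideanSpace ℝ (Fin n) → ℝ := fun y =>
    χ y ^ (2 * k) * inner ℝ (partialDeriv i v y) (v y) with hg
  have hgs : ContDiff ℝ ∞ g := (hχ.smooth.pow _).mul (hv1.inner ℝ hv)
  -- `1 ≤ k`, so that the power of `χ` in `g` is positive and the boundary terms vanish
  have hgt : tsupport g ⊆ tsupport χ := by
    refine closure_mono fun y hy hy' => hy ?_
    simp only [hg, hy']
    rw [zero_pow (by omega), zero_mul]
  have hgc : HasCompactSupport g :=
    hχ.isCompact.of_isClosed_subset (isClosed_tsupport g) (hgt.trans hχ.tsupport_subset)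
  have hg0 : ∫ y in K, partialDeriv i g y = 0 := by
    rw [setIntegral_eq_integral_of_forall_compl_eq_zero]
    · exact integral_partialDeriv_eq_zero hgs hgc i
    · intro y hy
      exact image_eq_zero_of_notMem_tsupport fun h =>
        hy (hχ.tsupport_subset (hgt (tsupport_partialDeriv_subset i g h)))
  have hgd : ∀ y, partialDeriv i g y =
      χ y ^ (2 * k) * (inner ℝ (partialDeriv i v y) (partialDeriv i v y) +
        inner ℝ (partialDeriv i (partialDeriv i v) y) (v y)) +
      inner ℝ (partialDeriv i v y) (v y) * (2 * k * χ y ^ (2 * k - 1) * partialDeriv i χ y) := by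
    intro y
    have h1 := (hχ.smooth.differentiable (by simp) y).hasFDerivAt.pow (2 * k)
    have h2 := (hv1.differentiable (by simp) y).hasFDerivAt.inner ℝ
      (hv.differentiable (by simp) y).hasFDerivAt
    have h3 := (h1.mul h2).fderiv
    have h4 : partialDeriv i g y = fderiv ℝ ((fun x => χ x ^ (2 * k)) *
      fun t => inner ℝ (partialDeriv i v t) (v t)) y (EuclideanSpace.single i 1) := rfl
    rw [h4, h3]
    simp [partialDeriv]
  have hI : ∀ f : EuclideanSpace ℝ (Fin n) → ℝ, Continuous f → IntegrableOn f K := fun f hf =>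
    hf.continuousOn.integrableOn_compact hχ.isCompact
  have hc1 := hv1.continuous
  have hc2 := hv2.continuous
  have hc0 := hv.continuous
  have hcχ := hχ.smooth.continuous
  have hcg := (contDiff_partialDeriv i hgs).continuous
  have hpt : ∀ y ∈ K, (χ y ^ k * ‖partialDeriv i v y‖) ^ 2 ≤ 2 * partialDeriv i g y +
      (ε * (χ y ^ (k + m) * ‖partialDeriv i (partialDeriv i v) y‖) ^ 2 +
        (4 * k ^ 2 * M ^ 2 + ε⁻¹) * (χ y ^ (k - m) * ‖v y‖) ^ 2) := by
    intro y hy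
    have hx0 := hχ.nonneg y
    set X := χ y ^ k * ‖partialDeriv i v y‖ with hX
    set a := χ y ^ (k + m) * ‖partialDeriv i (partialDeriv i v) y‖ with ha
    set b := χ y ^ (k - m) * ‖v y‖ with hb
    have hX0 : 0 ≤ X := by positivity
    have ha0 : 0 ≤ a := by positivity
    have hb0 : 0 ≤ b := by positivity
    have hM0 : 0 ≤ M := (norm_nonneg _).trans (hM y hy)
    have e1 : χ y ^ (2 * k) * inner ℝ (partialDeriv i v y) (partialDeriv i v y) = X ^ 2 := by
      rw [real_inner_self_eq_norm_sq, hX, mul_pow, ← pow_mul, mul_comm k]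
    have e2 : |χ y ^ (2 * k) * inner ℝ (partialDeriv i (partialDeriv i v) y) (v y)| ≤ a * b := by
      rw [abs_mul, abs_of_nonneg (by positivity)]
      calc _ ≤ χ y ^ (2 * k) * (‖partialDeriv i (partialDeriv i v) y‖ * ‖v y‖) := by
            gcongr; exact abs_real_inner_le_norm _ _
        _ = a * b := by
            rw [ha, hb, show 2 * k = (k + m) + (k - m) by omega, pow_add]; ring
    have e3 : |inner ℝ (partialDeriv i v y) (v y) *
        (2 * k * χ y ^ (2 * k - 1) * partialDeriv i χ y)| ≤ 2 * k * M * (X * b) := by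
      rw [abs_mul, abs_mul, abs_mul, abs_of_nonneg (by positivity : (0:ℝ) ≤ 2 * k),
        abs_of_nonneg (by positivity : 0 ≤ χ y ^ (2 * k - 1))]
      have hpow : χ y ^ (2 * k - 1) ≤ χ y ^ k * χ y ^ (k - m) := by
        rw [← pow_add]; exact pow_le_pow_of_le_one hx0 (hχ.le_one y) (by omega)
      calc _ ≤ (‖partialDeriv i v y‖ * ‖v y‖) * (2 * k * (χ y ^ k * χ y ^ (k - m)) * M) := by
            gcongr
            · exact abs_real_inner_le_norm _ _
            · exact hM y hy
        _ = _ := by rw [hX, hb]; ring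
    rw [hgd y, mul_add (χ y ^ (2 * k)), e1]
    have f1 := abs_le.1 e2
    have f2 := abs_le.1 e3
    have y1 : 2 * (a * b) ≤ ε * a ^ 2 + ε⁻¹ * b ^ 2 := by
      have : 0 ≤ ε⁻¹ * (ε * a - b) ^ 2 := by positivity
      have h : ε⁻¹ * (ε * a - b) ^ 2 = ε * a ^ 2 + ε⁻¹ * b ^ 2 - 2 * (a * b) := by
        field_simp; ring
      linarith
    have y2 : 4 * k * M * (X * b) ≤ X ^ 2 + 4 * k ^ 2 * M ^ 2 * b ^ 2 := by
      nlinarith [sq_nonneg (X - 2 * k * M * b)]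
    nlinarith [f1.1, f2.1]
  calc ∫ y in K, (χ y ^ k * ‖partialDeriv i v y‖) ^ 2
      ≤ ∫ y in K, (2 * partialDeriv i g y +
      (ε * (χ y ^ (k + m) * ‖partialDeriv i (partialDeriv i v) y‖) ^ 2 +
        (4 * k ^ 2 * M ^ 2 + ε⁻¹) * (χ y ^ (k - m) * ‖v y‖) ^ 2)) := by
        refine setIntegral_mono_on (hI _ (by fun_prop)) (hI _ (by fun_prop))
          hχ.isCompact.measurableSet hpt
    _ = _ := by
        rw [integral_add (hI _ (by fun_prop)) (hI _ (by fun_prop)),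
          integral_add (hI _ (by fun_prop)) (hI _ (by fun_prop)), integral_const_mul,
          integral_const_mul, integral_const_mul, hg0]
        ring

/-- If every intermediate term of a family of finite sequences is bounded by a small multiple of
all terms plus a multiple of the preceding ones, then the intermediate terms are bounded by a small
multiple of the last one plus a multiple of the first one. -/
theorem exists_sum_range_le_of_absorption {ι : Type*} {S : ι → ℕ → ℝ} (hS : ∀ v k, 0 ≤ S v k)
    {d : ℕ} (hd : 1 ≤ d)
    (h : ∀ k, 1 ≤ k → k < d → ∀ ε : ℝ, 0 < ε → ∃ C : ℝ, 0 ≤ C ∧ ∀ v,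
      S v k ≤ ε * ∑ j ∈ Finset.range (d + 1), S v j + C * ∑ j ∈ Finset.range k, S v j)
    {ε : ℝ} (hε : 0 < ε) :
    ∃ C : ℝ, 0 ≤ C ∧ ∀ v, ∑ j ∈ Finset.range d, S v j ≤ ε * S v d + C * S v 0 := by
  have key : ∀ k, 1 ≤ k → k ≤ d → ∀ ε : ℝ, 0 < ε → ∃ C : ℝ, 0 ≤ C ∧ ∀ v,
      ∑ j ∈ Finset.range k, S v j ≤ ε * ∑ j ∈ Finset.range (d + 1), S v j + C * S v 0 := by
    intro k hk
    induction k, hk using Nat.le_induction with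
    | base =>
      refine fun _ ε hε => ⟨1, zero_le_one, fun v => ?_⟩
      have : 0 ≤ ∑ j ∈ Finset.range (d + 1), S v j := Finset.sum_nonneg fun j _ => hS v j
      simp only [Finset.sum_range_one, one_mul]
      nlinarith
    | succ k hk ih =>
      intro hkd ε hε
      obtain ⟨C, hC, hCv⟩ := h k hk (by omega) (ε / 2) (by positivity)
      obtain ⟨C', hC', hCv'⟩ := ih (by omega) (ε / (2 * (1 + C))) (by positivity)
      refine ⟨(1 + C) * C', by positivity, fun v => ?_⟩
      rw [Finset.sum_range_succ]
      calc _ ≤ (1 + C) * ∑ j ∈ Finset.range k, S v j +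
            ε / 2 * ∑ j ∈ Finset.range (d + 1), S v j := by linarith [hCv v]
        _ ≤ (1 + C) * (ε / (2 * (1 + C)) * ∑ j ∈ Finset.range (d + 1), S v j + C' * S v 0) +
            ε / 2 * ∑ j ∈ Finset.range (d + 1), S v j := by
            have := mul_le_mul_of_nonneg_left (hCv' v) (by positivity : 0 ≤ 1 + C)
            linarith
        _ = _ := by field_simp; ring
  obtain ⟨C, hC, hCv⟩ := key d hd le_rfl (min (1 / 2) (ε / 2)) (by positivity)
  refine ⟨2 * C, by positivity, fun v => ?_⟩
  have h1 := hCv v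
  rw [Finset.sum_range_succ] at h1
  have h2 : 0 ≤ ∑ j ∈ Finset.range d, S v j := Finset.sum_nonneg fun j _ => hS v j
  have h3 := mul_le_mul_of_nonneg_right (min_le_left (1 / 2 : ℝ) (ε / 2)) h2
  have h4 := mul_le_mul_of_nonneg_right (min_le_right (1 / 2 : ℝ) (ε / 2)) (hS v d)
  linarith

/-- The sum of the squared `L²(K)` norms of `χ^k ∂_w v` over the words `w` of weight `k`. -/
def mass {E : Type*} [NormedAddCommGroup E] [NormedSpace ℝ E] (p : ℕ)
    (χ : EuclideanSpace ℝ (Fin n) → ℝ) (K : Set (EuclideanSpace ℝ (Fin n)))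
    (v : EuclideanSpace ℝ (Fin n) → E) (k : ℕ) : ℝ :=
  ∑ w ∈ words n p k, ∫ y in K, (χ y ^ k * ‖wordDeriv w v y‖) ^ 2

section Mass

variable {E : Type*} [NormedAddCommGroup E] [NormedSpace ℝ E]

theorem integral_le_mass {p : ℕ} {χ : EuclideanSpace ℝ (Fin n) → ℝ}
    {K : Set (EuclideanSpace ℝ (Fin n))} {v : EuclideanSpace ℝ (Fin n) → E} {k : ℕ}
    {w : List (Fin n)} (hw : wordWeight p w = k) :
    ∫ y in K, (χ y ^ k * ‖wordDeriv w v y‖) ^ 2 ≤ mass p χ K v k :=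
  Finset.single_le_sum (f := fun w => ∫ y in K, (χ y ^ k * ‖wordDeriv w v y‖) ^ 2)
    (fun _ _ => integral_nonneg fun _ => by positivity) (mem_words.2 hw)

theorem mass_nonneg (p : ℕ) (χ : EuclideanSpace ℝ (Fin n) → ℝ)
    (K : Set (EuclideanSpace ℝ (Fin n))) (v : EuclideanSpace ℝ (Fin n) → E) (k : ℕ) :
    0 ≤ mass p χ K v k :=
  Finset.sum_nonneg fun _ _ => integral_nonneg fun _ => by positivity

theorem mass_zero (p : ℕ) (χ : EuclideanSpace ℝ (Fin n) → ℝ)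
    (K : Set (EuclideanSpace ℝ (Fin n))) (v : EuclideanSpace ℝ (Fin n) → E) :
    mass p χ K v 0 = ∫ y in K, ‖v y‖ ^ 2 := by
  simp [mass, words_zero]

end Mass

theorem exists_mass_le {E : Type*} [NormedAddCommGroup E] [InnerProductSpace ℝ E] {p k d : ℕ}
    {χ : EuclideanSpace ℝ (Fin n) → ℝ} {K : Set (EuclideanSpace ℝ (Fin n))} (hχ : IsCutoff χ K)
    (hw : ∀ w : List (Fin n), wordWeight p w = k → ∃ i ∈ w, k + letterWeight p i ≤ d)
    {ε : ℝ} (hε : 0 < ε) :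
    ∃ C : ℝ, 0 ≤ C ∧ ∀ v : EuclideanSpace ℝ (Fin n) → E, ContDiff ℝ ∞ v →
      mass p χ K v k ≤ ε * ∑ j ∈ Finset.range (d + 1), mass p χ K v j +
        C * ∑ j ∈ Finset.range k, mass p χ K v j := by
  have key : ∀ δ : ℝ, 0 < δ → ∀ w : words n p k, ∃ C : ℝ, 0 ≤ C ∧
      ∀ v : EuclideanSpace ℝ (Fin n) → E, ContDiff ℝ ∞ v →
        ∫ y in K, (χ y ^ k * ‖wordDeriv w v y‖) ^ 2 ≤
          δ * ∑ j ∈ Finset.range (d + 1), mass p χ K v j +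
            C * ∑ j ∈ Finset.range k, mass p χ K v j := by
    rintro δ hδ ⟨w, hwk⟩
    have hwk := mem_words.1 hwk
    obtain ⟨i, hi, hid⟩ := hw w hwk
    have hperm := List.perm_cons_erase hi
    have hwt := wordWeight_perm p hperm
    rw [hwk, wordWeight_cons] at hwt
    have hl := one_le_letterWeight p i
    obtain ⟨C, hC, hCv⟩ := exists_integral_partialDeriv_sq_le (E := E) hχ i hl
      (k := k) (by omega) hδ
    refine ⟨C, hC, fun v hv => ?_⟩
    rw [wordDeriv_perm hperm hv]
    refine (hCv _ (contDiff_wordDeriv (w.erase i) hv)).trans ?_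
    gcongr
    · refine (integral_le_mass (w := i :: i :: w.erase i) (p := p) ?_).trans
        (Finset.single_le_sum (f := fun j => mass p χ K v j) (fun j _ => mass_nonneg p χ K v j)
          (Finset.mem_range.2 (by omega)))
      simp only [wordWeight_cons]; omega
    · refine (integral_le_mass (w := w.erase i) (p := p) (by omega)).trans
        (Finset.single_le_sum (f := fun j => mass p χ K v j) (fun j _ => mass_nonneg p χ K v j)
          (Finset.mem_range.2 (by omega)))
  set N : ℝ := ((words n p k).card : ℝ) with hN
  choose C hC hCv using key (ε / (N + 1)) (by positivity)
  refine ⟨∑ w, C w, Finset.sum_nonneg fun w _ => hC w, fun v hv => ?_⟩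
  have hpos : 0 ≤ ∑ j ∈ Finset.range (d + 1), mass p χ K v j :=
    Finset.sum_nonneg fun j _ => mass_nonneg p χ K v j
  calc mass p χ K v k = ∑ w : words n p k, ∫ y in K, (χ y ^ k * ‖wordDeriv w v y‖) ^ 2 :=
        (Finset.sum_coe_sort _ fun w => ∫ y in K, (χ y ^ k * ‖wordDeriv w v y‖) ^ 2).symm
    _ ≤ ∑ w : words n p k, (ε / (N + 1) * ∑ j ∈ Finset.range (d + 1), mass p χ K v j +
            C w * ∑ j ∈ Finset.range k, mass p χ K v j) :=
        Finset.sum_le_sum fun w _ => hCv w v hv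
    _ = N * (ε / (N + 1)) * ∑ j ∈ Finset.range (d + 1), mass p χ K v j +
          (∑ w, C w) * ∑ j ∈ Finset.range k, mass p χ K v j := by
        rw [Finset.sum_add_distrib, Finset.sum_mul]
        simp [hN]
        ring
    _ ≤ _ := by
        gcongr
        rw [mul_div_assoc', div_le_iff₀ (by positivity)]
        nlinarith

/-- Interpolation between the localized norms of weights `0` and `d`. The hypothesis on words holds
except when `d` is odd and some direction has weight two. -/
theorem exists_sum_mass_le {E : Type*} [NormedAddCommGroup E] [InnerProductSpace ℝ E] {p d : ℕ}
    (hd : 1 ≤ d) {χ : EuclideanSpace ℝ (Fin n) → ℝ} {K : Set (EuclideanSpace ℝ (Fin n))}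
    (hχ : IsCutoff χ K)
    (hw : ∀ w : List (Fin n), 1 ≤ wordWeight p w → wordWeight p w < d →
      ∃ i ∈ w, wordWeight p w + letterWeight p i ≤ d) {ε : ℝ} (hε : 0 < ε) :
    ∃ C : ℝ, 0 ≤ C ∧ ∀ v : EuclideanSpace ℝ (Fin n) → E, ContDiff ℝ ∞ v →
      ∑ j ∈ Finset.range d, mass p χ K v j ≤ ε * mass p χ K v d + C * ∫ y in K, ‖v y‖ ^ 2 := by
  obtain ⟨C, hC, hCv⟩ := exists_sum_range_le_of_absorption
    (S := fun (v : {v : EuclideanSpace ℝ (Fin n) → E // ContDiff ℝ ∞ v}) k => mass p χ K v.1 k)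
    (fun v k => mass_nonneg _ _ _ _ _) hd (fun k hk hkd ε hε => by
      obtain ⟨C, hC, hCv⟩ := exists_mass_le (E := E) (d := d) (k := k) hχ
        (fun w h => h ▸ hw w (h ▸ hk) (h ▸ hkd)) hε
      exact ⟨C, hC, fun v => hCv v.1 v.2⟩) hε
  exact ⟨C, hC, fun v hv => mass_zero p χ K v ▸ hCv ⟨v, hv⟩⟩

end Interpolation

/-! ### Commuting derivatives with powers of a cut-off -/

section Leibniz

variable {n : ℕ}

/-- The finite set of words of weight less than `d`. -/
def lowWords (n p d : ℕ) : Finset (List (Fin n)) := (Finset.range d).biUnion (words n p)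

@[simp] theorem mem_lowWords {n p d : ℕ} {w : List (Fin n)} :
    w ∈ lowWords n p d ↔ wordWeight p w < d := by simp [lowWords]

theorem sum_lowWords {n p d : ℕ} (f : List (Fin n) → ℝ) :
    ∑ w ∈ lowWords n p d, f w = ∑ j ∈ Finset.range d, ∑ w ∈ words n p j, f w := by
  refine Finset.sum_biUnion fun i _ j _ hij => ?_
  refine Finset.disjoint_left.2 fun w hi hj => hij ?_
  rw [← mem_words.1 hi, ← mem_words.1 hj]

variable {E : Type*} [NormedAddCommGroup E] [NormedSpace ℝ E]

/-- The terms of lower weight that arise when a derivative of weight `d` is commuted with `χ ^ k`: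
every unit of weight that is lost by the derivative costs one power of `χ`. -/
def lowerTerms (p : ℕ) (χ : EuclideanSpace ℝ (Fin n) → ℝ) (k d : ℕ)
    (v : EuclideanSpace ℝ (Fin n) → E) (y : EuclideanSpace ℝ (Fin n)) : ℝ :=
  ∑ w ∈ lowWords n p d, χ y ^ (k + wordWeight p w - d) * ‖wordDeriv w v y‖

theorem lowerTerms_nonneg {χ : EuclideanSpace ℝ (Fin n) → ℝ}
    {K : Set (EuclideanSpace ℝ (Fin n))} (hχ : IsCutoff χ K) (p k d : ℕ)
    (v : EuclideanSpace ℝ (Fin n) → E) (y : EuclideanSpace ℝ (Fin n)) :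
    0 ≤ lowerTerms p χ k d v y :=
  Finset.sum_nonneg fun _ _ => mul_nonneg (pow_nonneg (hχ.nonneg y) _) (norm_nonneg _)

theorem mul_norm_wordDeriv_le_lowerTerms {χ : EuclideanSpace ℝ (Fin n) → ℝ}
    {K : Set (EuclideanSpace ℝ (Fin n))} (hχ : IsCutoff χ K) {p k d e : ℕ} {w : List (Fin n)}
    (hw : wordWeight p w < d) (he : k + wordWeight p w - d ≤ e)
    (v : EuclideanSpace ℝ (Fin n) → E) (y : EuclideanSpace ℝ (Fin n)) :
    χ y ^ e * ‖wordDeriv w v y‖ ≤ lowerTerms p χ k d v y := by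
  refine le_trans ?_ (Finset.single_le_sum (f := fun w =>
    χ y ^ (k + wordWeight p w - d) * ‖wordDeriv w v y‖)
    (fun w _ => mul_nonneg (pow_nonneg (hχ.nonneg y) _) (norm_nonneg _)) (mem_lowWords.2 hw))
  exact mul_le_mul_of_nonneg_right
    (pow_le_pow_of_le_one (hχ.nonneg y) (hχ.le_one y) he) (norm_nonneg _)

/-- A Leibniz rule for `∂_w (c χ^k v)`, by induction on the innermost letter of the word. The
auxiliary coefficient `c` collects the derivatives of the cut-off. -/
theorem exists_norm_wordDeriv_smul_sub_le {χ : EuclideanSpace ℝ (Fin n) → ℝ}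
    {K : Set (EuclideanSpace ℝ (Fin n))} (hχ : IsCutoff χ K) (p : ℕ) (w : List (Fin n)) :
    ∀ (c : EuclideanSpace ℝ (Fin n) → ℝ) (k : ℕ), ContDiff ℝ ∞ c → wordWeight p w ≤ k →
      ∃ C : ℝ, 0 ≤ C ∧ ∀ v : EuclideanSpace ℝ (Fin n) → E, ContDiff ℝ ∞ v → ∀ y ∈ K,
        ‖wordDeriv w (fun y => (c y * χ y ^ k) • v y) y - (c y * χ y ^ k) • wordDeriv w v y‖ ≤
          C * lowerTerms p χ k (wordWeight p w) v y := by
  induction w using List.reverseRecOn with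
  | nil => exact fun c k _ _ => ⟨0, le_rfl, fun v _ y _ => by simp⟩
  | append_singleton w i ih =>
    intro c k hc hk
    have hm := one_le_letterWeight p i
    have hwt : wordWeight p (w ++ [i]) = wordWeight p w + letterWeight p i := by
      rw [wordWeight_append]; simp
    rw [hwt] at hk ⊢
    set W := wordWeight p w with hW
    set m := letterWeight p i with hmdef
    set c' : EuclideanSpace ℝ (Fin n) → ℝ := fun y =>
      partialDeriv i c y * χ y + k * c y * partialDeriv i χ y with hc'
    have hc's : ContDiff ℝ ∞ c' := ((contDiff_partialDeriv i hc).mul hχ.smooth).add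
      ((contDiff_const.mul hc).mul (contDiff_partialDeriv i hχ.smooth))
    obtain ⟨M, hM⟩ := hχ.isCompact.exists_bound_of_continuousOn hc's.continuous.continuousOn
    obtain ⟨C₁, hC₁, h₁⟩ := ih c' (k - 1) hc's (by omega)
    obtain ⟨C₂, hC₂, h₂⟩ := ih c k hc (by omega)
    set N : ℝ := ((lowWords n p W).card : ℝ) with hN
    refine ⟨max M 0 + C₁ * N + C₂ * N, by positivity, fun v hv y hy => ?_⟩
    have hprod : ∀ y, partialDeriv i (fun y => c y * χ y ^ k) y = c' y * χ y ^ (k - 1) := by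
      intro y
      have h1 := (hχ.smooth.differentiable (by simp) y).hasFDerivAt.pow k
      have h2 := (hc.differentiable (by simp) y).hasFDerivAt
      have h3 := (h2.mul h1).fderiv
      have h4 : partialDeriv i (fun y => c y * χ y ^ k) y =
        fderiv ℝ (c * fun x => χ x ^ k) y (EuclideanSpace.single i 1) := rfl
      have h5 : χ y ^ k = χ y ^ (k - 1) * χ y := by
        rw [← pow_succ]; congr 1; omega
      rw [h4, h3]
      simp [partialDeriv, hc', h5]
      ring
    have hcχ : ContDiff ℝ ∞ fun y => c y * χ y ^ k := hc.mul (hχ.smooth.pow k)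
    have hexp : wordDeriv (w ++ [i]) (fun y => (c y * χ y ^ k) • v y) y =
        wordDeriv w (fun y => (c' y * χ y ^ (k - 1)) • v y) y +
          wordDeriv w (fun y => (c y * χ y ^ k) • partialDeriv i v y) y := by
      rw [wordDeriv_append, wordDeriv_cons, wordDeriv_nil, partialDeriv_smul i hcχ hv]
      have hs₁ : ContDiff ℝ ∞ fun y => partialDeriv i (fun y => c y * χ y ^ k) y • v y :=
        (contDiff_partialDeriv i hcχ).smul hv
      have hs₂ : ContDiff ℝ ∞ fun y => (c y * χ y ^ k) • partialDeriv i v y :=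
        hcχ.smul (contDiff_partialDeriv i hv)
      rw [wordDeriv_add w hs₁ hs₂]
      simp only [hprod, Pi.add_apply]
    have hx0 := hχ.nonneg y
    set T := lowerTerms p χ k (W + m) v y with hT
    have hT0 : 0 ≤ T := lowerTerms_nonneg hχ _ _ _ _ _
    have b1 : lowerTerms p χ (k - 1) W v y ≤ N * T := by
      rw [hN, ← nsmul_eq_mul]
      refine Finset.sum_le_card_nsmul _ _ _ fun w' hw' => ?_
      have := mem_lowWords.1 hw'
      exact mul_norm_wordDeriv_le_lowerTerms hχ (by omega) (by omega) v y
    have b2 : lowerTerms p χ k W (partialDeriv i v) y ≤ N * T := by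
      rw [hN, ← nsmul_eq_mul]
      refine Finset.sum_le_card_nsmul _ _ _ fun w' hw' => ?_
      have := mem_lowWords.1 hw'
      have hwt' : wordWeight p (w' ++ [i]) = wordWeight p w' + m := by
        rw [wordWeight_append]; simp [hmdef]
      have hd : wordDeriv w' (partialDeriv i v) = wordDeriv (w' ++ [i]) v := by
        rw [wordDeriv_append]; rfl
      rw [hd]
      exact mul_norm_wordDeriv_le_lowerTerms hχ (by omega) (by omega) v y
    have b3 : ‖(c' y * χ y ^ (k - 1)) • wordDeriv w v y‖ ≤ max M 0 * T := by
      rw [norm_smul, norm_mul, norm_pow, Real.norm_of_nonneg hx0, mul_assoc]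
      refine mul_le_mul ((hM y hy).trans (le_max_left _ _)) ?_ (by positivity) (le_max_right _ _)
      exact mul_norm_wordDeriv_le_lowerTerms hχ (by omega) (by omega) v y
    have a1 := h₁ v hv y hy
    have a2 := h₂ _ (contDiff_partialDeriv i hv) y hy
    have hd : wordDeriv (w ++ [i]) v y = wordDeriv w (partialDeriv i v) y := by
      rw [wordDeriv_append]; rfl
    rw [hexp, hd]
    calc _ = ‖(wordDeriv w (fun y => (c' y * χ y ^ (k - 1)) • v y) y -
            (c' y * χ y ^ (k - 1)) • wordDeriv w v y) +
          (c' y * χ y ^ (k - 1)) • wordDeriv w v y +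
          (wordDeriv w (fun y => (c y * χ y ^ k) • partialDeriv i v y) y -
            (c y * χ y ^ k) • wordDeriv w (partialDeriv i v) y)‖ := by congr 1; abel
      _ ≤ C₁ * lowerTerms p χ (k - 1) W v y + max M 0 * T +
          C₂ * lowerTerms p χ k W (partialDeriv i v) y :=
        (norm_add₃_le).trans (add_le_add_three a1 b3 a2)
      _ ≤ C₁ * (N * T) + max M 0 * T + C₂ * (N * T) := by gcongr
      _ = _ := by ring

/-- The squared lower terms of the Leibniz rule are controlled by the densities of the localized
norms of lower weight. -/
theorem exists_norm_wordDeriv_smul_sub_sq_le {χ : EuclideanSpace ℝ (Fin n) → ℝ}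
    {K : Set (EuclideanSpace ℝ (Fin n))} (hχ : IsCutoff χ K) (p d : ℕ) :
    ∃ C : ℝ, 0 ≤ C ∧ ∀ w : List (Fin n), wordWeight p w = d →
      ∀ v : EuclideanSpace ℝ (Fin n) → E, ContDiff ℝ ∞ v → ∀ y ∈ K,
        ‖wordDeriv w (fun y => χ y ^ d • v y) y - χ y ^ d • wordDeriv w v y‖ ^ 2 ≤
          C * ∑ w ∈ lowWords n p d, (χ y ^ wordWeight p w * ‖wordDeriv w v y‖) ^ 2 := by
  have key : ∀ w : words n p d, ∃ C : ℝ, 0 ≤ C ∧ ∀ v : EuclideanSpace ℝ (Fin n) → E,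
      ContDiff ℝ ∞ v → ∀ y ∈ K,
        ‖wordDeriv w (fun y => χ y ^ d • v y) y - χ y ^ d • wordDeriv w v y‖ ≤
          C * lowerTerms p χ d d v y := by
    rintro ⟨w, hw⟩
    have hw := mem_words.1 hw
    obtain ⟨C, hC, h⟩ := exists_norm_wordDeriv_smul_sub_le (E := E) hχ p w (fun _ => 1) d
      contDiff_const hw.le
    refine ⟨C, hC, fun v hv y hy => ?_⟩
    have := h v hv y hy
    simpa only [one_mul, hw] using this
  choose C hC hCv using key
  refine ⟨(∑ w, C w) ^ 2 * (lowWords n p d).card, by positivity, fun w hw v hv y hy => ?_⟩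
  have h1 : C ⟨w, mem_words.2 hw⟩ ≤ ∑ w, C w :=
    Finset.single_le_sum (fun w _ => hC w) (Finset.mem_univ _)
  have hT := lowerTerms_nonneg hχ p d d v y
  calc _ ≤ ((∑ w, C w) * lowerTerms p χ d d v y) ^ 2 := by
        gcongr
        exact (hCv ⟨w, mem_words.2 hw⟩ v hv y hy).trans (by gcongr)
    _ = (∑ w, C w) ^ 2 * lowerTerms p χ d d v y ^ 2 := by ring
    _ ≤ (∑ w, C w) ^ 2 * ((lowWords n p d).card *
          ∑ w ∈ lowWords n p d, (χ y ^ wordWeight p w * ‖wordDeriv w v y‖) ^ 2) := by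
        gcongr
        refine le_trans (le_of_eq ?_) (sq_sum_le_card_mul_sum_sq)
        simp [lowerTerms]
    _ = _ := by ring

end Leibniz

/-! ### The interior estimate -/

section Interior

variable {n : ℕ}

/-- A word of intermediate weight can be continued by one of its own letters without exceeding the
weight `d`, unless `d` is odd and there is a direction of weight two. In that case the symbol
vanishes in this direction, so that it is invertible only on the zero space. -/
theorem exists_letter_or_subsingleton {E : Type*} [NormedAddCommGroup E] [NormedSpace ℂ E]
    {F : Type*} [NormedAddCommGroup F] [NormedSpace ℂ F] {p d : ℕ}
    {b : (Fin n → ℕ) → E →L[ℂ] F}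
    (hb : ∀ η : Fin n → ℝ, η ≠ 0 → (constSymbol p d b η).IsInvertible) :
    (∀ w : List (Fin n), 1 ≤ wordWeight p w → wordWeight p w < d →
      ∃ i ∈ w, wordWeight p w + letterWeight p i ≤ d) ∨ Subsingleton E := by
  by_contra! h
  obtain ⟨⟨w, hw1, hwd, hw⟩, hE⟩ := h
  have hlet : ∀ i ∈ w, letterWeight p i = 2 := by
    intro i hi
    have h1 := hw i hi
    have h2 := letterWeight_le_two p i
    omega
  have heven : wordWeight p w = w.length * 2 := by
    rw [wordWeight, List.map_congr_left hlet, List.map_const', List.sum_replicate, smul_eq_mul]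
  obtain ⟨i, hi⟩ : ∃ i, i ∈ w := by
    rcases w with _ | ⟨i, w⟩
    · simp at hw1
    · exact ⟨i, by simp⟩
  have hi2 := hlet i hi
  have hid := hw i hi
  have hzero : constSymbol p d b (Pi.single i 1) = 0 := by
    refine Finset.sum_eq_zero fun α hα => ?_
    have hα' := (Finset.mem_filter.1 hα).2
    obtain ⟨j, hji, hj⟩ : ∃ j, j ≠ i ∧ α j ≠ 0 := by
      by_contra! hall
      have : weight p α = letterWeight p i * α i :=
        Finset.sum_eq_single i (fun j _ hj => by simp [hall j hj]) (by simp)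
      rw [hi2, hα'] at this
      omega
    rw [Finset.prod_eq_zero (Finset.mem_univ j), zero_smul]
    rw [Pi.single_eq_of_ne hji]
    simp [hj]
  have hne : (Pi.single i 1 : Fin n → ℝ) ≠ 0 := by simp
  obtain ⟨e, he⟩ := hb _ hne
  rw [hzero] at he
  refine not_subsingleton E ⟨fun x y => e.injective ?_⟩
  have h0 : ∀ z, e z = 0 := fun z => by
    have := congrArg (fun L : E →L[ℂ] F => L z) he
    simpa using this
  rw [h0, h0]

theorem ball_cutoff {y₀ : EuclideanSpace ℝ (Fin n)} {R : ℝ} (hR : 0 < R) :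
    ∃ χ : EuclideanSpace ℝ (Fin n) → ℝ, IsCutoff χ (Metric.closedBall y₀ R) ∧
      ∀ y ∈ Metric.closedBall y₀ (R / 2), χ y = 1 := by
  let f : ContDiffBump y₀ := ⟨R / 2, R, by positivity, by linarith⟩
  refine ⟨f, ⟨f.contDiff, fun y => f.nonneg, fun y => f.le_one, isCompact_closedBall _ _, ?_⟩,
    fun y hy => f.one_of_mem_closedBall hy⟩
  rw [f.tsupport_eq]

variable {E : Type*} [NormedAddCommGroup E] [InnerProductSpace ℂ E]
  {F : Type*} [NormedAddCommGroup F] [InnerProductSpace ℂ F]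

/-- The top-order part of `P`, with coefficients frozen at a point, applied to `χ^d v`, compared
with `P v`: the oscillation `δ` of the coefficients enters only in front of the terms of weight
`d`. -/
theorem exists_norm_frozen_sq_le {p d : ℕ} {χ : EuclideanSpace ℝ (Fin n) → ℝ}
    {K : Set (EuclideanSpace ℝ (Fin n))} (hχ : IsCutoff χ K)
    {a : (Fin n → ℕ) → EuclideanSpace ℝ (Fin n) → E →L[ℂ] F} {b : (Fin n → ℕ) → E →L[ℂ] F}
    {δ M : ℝ} (hδ0 : 0 ≤ δ) (hM0 : 0 ≤ M)
    (hδ : ∀ α ∈ multiIndices n p d, ∀ y ∈ K, ‖a α y - b α‖ ≤ δ)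
    (hM : ∀ α ∈ multiIndices n p d, ∀ y ∈ K, ‖a α y‖ ≤ M)
    (hb : ∀ α ∈ multiIndices n p d, ‖b α‖ ≤ M) :
    ∃ C : ℝ, 0 ≤ C ∧ ∀ v : EuclideanSpace ℝ (Fin n) → E, ContDiff ℝ ∞ v → ∀ y ∈ K,
      ‖∑ α ∈ (multiIndices n p d).filter (fun α => weight p α = d),
          b α (wordDeriv (wordOf α) (fun y => χ y ^ d • v y) y)‖ ^ 2 ≤
        4 * ‖∑ α ∈ multiIndices n p d, a α y (wordDeriv (wordOf α) v y)‖ ^ 2 +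
        4 * ((multiIndices n p d).card * δ) ^ 2 *
          ∑ w ∈ words n p d, (χ y ^ d * ‖wordDeriv w v y‖) ^ 2 +
        C * ∑ w ∈ lowWords n p d, (χ y ^ wordWeight p w * ‖wordDeriv w v y‖) ^ 2 := by
  obtain ⟨C, hC, hCv⟩ := exists_norm_wordDeriv_smul_sub_sq_le (E := E) hχ p d
  set N : ℝ := ((multiIndices n p d).card : ℝ) with hN
  refine ⟨4 * (N * M) ^ 2 + 4 * (N * M) ^ 2 * C, by positivity, fun v hv y hy => ?_⟩
  set I := multiIndices n p d with hI
  set top := ∑ w ∈ words n p d, (χ y ^ d * ‖wordDeriv w v y‖) ^ 2 with htop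
  set low := ∑ w ∈ lowWords n p d, (χ y ^ wordWeight p w * ‖wordDeriv w v y‖) ^ 2 with hlow
  have htop0 : 0 ≤ top := Finset.sum_nonneg fun _ _ => by positivity
  have hlow0 : 0 ≤ low := Finset.sum_nonneg fun _ _ => by positivity
  have hx0 := hχ.nonneg y
  have hx1 := hχ.le_one y
  set D : (Fin n → ℕ) → E := fun α => wordDeriv (wordOf α) v y with hD
  have t1 : ∀ α ∈ I.filter (fun α => weight p α = d), χ y ^ d * ‖D α‖ ≤ √top := by
    intro α hα
    refine Real.le_sqrt_of_sq_le ?_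
    exact Finset.single_le_sum (f := fun w => (χ y ^ d * ‖wordDeriv w v y‖) ^ 2)
      (fun _ _ => by positivity)
      (mem_words.2 ((wordWeight_wordOf p α).trans (Finset.mem_filter.1 hα).2))
  have t2 : ∀ α ∈ I.filter (fun α => ¬ weight p α = d), χ y ^ d * ‖D α‖ ≤ √low := by
    intro α hα
    refine Real.le_sqrt_of_sq_le ?_
    obtain ⟨h1, h2⟩ := Finset.mem_filter.1 hα
    have h3 : wordWeight p (wordOf α) < d := by
      rw [wordWeight_wordOf]; exact lt_of_le_of_ne (mem_multiIndices.1 h1) h2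
    refine le_trans ?_ (Finset.single_le_sum
      (f := fun w => (χ y ^ wordWeight p w * ‖wordDeriv w v y‖) ^ 2)
      (fun _ _ => by positivity) (mem_lowWords.2 h3))
    exact pow_le_pow_left₀ (by positivity) (mul_le_mul_of_nonneg_right
      (pow_le_pow_of_le_one hx0 hx1 h3.le) (norm_nonneg _)) 2
  have t3 : ∀ α ∈ I.filter (fun α => weight p α = d),
      ‖wordDeriv (wordOf α) (fun y => χ y ^ d • v y) y - χ y ^ d • D α‖ ≤ √(C * low) := fun α hα =>
    Real.le_sqrt_of_sq_le
      (hCv _ ((wordWeight_wordOf p α).trans (Finset.mem_filter.1 hα).2) v hv y hy)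
  have hcard : ∀ q : (Fin n → ℕ) → Prop, [DecidablePred q] → ∀ (g : (Fin n → ℕ) → F) (B : ℝ),
      0 ≤ B → (∀ α ∈ I.filter q, ‖g α‖ ≤ B) → ‖∑ α ∈ I.filter q, g α‖ ≤ N * B := by
    intro q _ g B hB hg
    refine (norm_sum_le_of_le _ hg).trans ?_
    rw [Finset.sum_const, nsmul_eq_mul]
    gcongr
    exact Nat.cast_le.2 (Finset.card_filter_le _ _)
  -- freeze the coefficients, drop the terms of lower weight, and commute `χ^d` to the front
  have hsplit : ∑ α ∈ I.filter (fun α => weight p α = d),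
      b α (wordDeriv (wordOf α) (fun y => χ y ^ d • v y) y) =
      χ y ^ d • (∑ α ∈ I, a α y (D α)) -
      ∑ α ∈ I.filter (fun α => weight p α = d), χ y ^ d • (a α y - b α) (D α) -
      ∑ α ∈ I.filter (fun α => ¬ weight p α = d), χ y ^ d • a α y (D α) +
      ∑ α ∈ I.filter (fun α => weight p α = d),
        b α (wordDeriv (wordOf α) (fun y => χ y ^ d • v y) y - χ y ^ d • D α) := by
    have hsmul : ∀ α, b α (χ y ^ d • D α) = χ y ^ d • b α (D α) := fun α =>
      (b α).map_smul_of_tower _ _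
    simp only [map_sub, hsmul, sub_apply, smul_sub, Finset.sum_sub_distrib]
    rw [← Finset.sum_filter_add_sum_filter_not I (fun α => weight p α = d), smul_add,
      Finset.smul_sum, Finset.smul_sum]
    abel
  have hxd : 0 ≤ χ y ^ d := by positivity
  have n1 : ‖χ y ^ d • (∑ α ∈ I, a α y (D α))‖ ≤ ‖∑ α ∈ I, a α y (D α)‖ := by
    rw [norm_smul, Real.norm_of_nonneg hxd]
    exact mul_le_of_le_one_left (norm_nonneg _) (pow_le_one₀ hx0 hx1)
  have n2 : ‖∑ α ∈ I.filter (fun α => weight p α = d), χ y ^ d • (a α y - b α) (D α)‖ ≤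
      N * (δ * √top) := by
    refine hcard _ _ _ (by positivity) fun α hα => ?_
    rw [norm_smul, Real.norm_of_nonneg hxd]
    calc _ ≤ χ y ^ d * (δ * ‖D α‖) := by
          gcongr
          exact (a α y - b α).le_of_opNorm_le (hδ α (Finset.mem_filter.1 hα).1 y hy) _
      _ = δ * (χ y ^ d * ‖D α‖) := by ring
      _ ≤ _ := by gcongr; exact t1 α hα
  have n3 : ‖∑ α ∈ I.filter (fun α => ¬ weight p α = d), χ y ^ d • a α y (D α)‖ ≤
      N * (M * √low) := by
    refine hcard _ _ _ (by positivity) fun α hα => ?_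
    rw [norm_smul, Real.norm_of_nonneg hxd]
    calc _ ≤ χ y ^ d * (M * ‖D α‖) := by
          gcongr
          exact (a α y).le_of_opNorm_le (hM α (Finset.mem_filter.1 hα).1 y hy) _
      _ = M * (χ y ^ d * ‖D α‖) := by ring
      _ ≤ _ := by gcongr; exact t2 α hα
  have n4 : ‖∑ α ∈ I.filter (fun α => weight p α = d),
        b α (wordDeriv (wordOf α) (fun y => χ y ^ d • v y) y - χ y ^ d • D α)‖ ≤
      N * (M * √(C * low)) := by
    refine hcard _ _ _ (by positivity) fun α hα => ?_
    refine ((b α).le_of_opNorm_le (hb α (Finset.mem_filter.1 hα).1) _).trans ?_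
    gcongr
    exact t3 α hα
  rw [hsplit]
  have hnorm := (norm_add_le _ _).trans (add_le_add ((norm_sub_le _ _).trans
    (add_le_add ((norm_sub_le _ _).trans (add_le_add n1 n2)) n3)) n4)
  have s1 : √top ^ 2 = top := Real.sq_sqrt htop0
  have s2 : √low ^ 2 = low := Real.sq_sqrt hlow0
  have s3 : √(C * low) ^ 2 = C * low := Real.sq_sqrt (by positivity)
  have four : ∀ x₁ x₂ x₃ x₄ : ℝ,
      (x₁ + x₂ + x₃ + x₄) ^ 2 ≤ 4 * x₁ ^ 2 + 4 * x₂ ^ 2 + 4 * x₃ ^ 2 + 4 * x₄ ^ 2 := by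
    intro x₁ x₂ x₃ x₄
    nlinarith [sq_nonneg (x₁ - x₂), sq_nonneg (x₁ - x₃), sq_nonneg (x₁ - x₄),
      sq_nonneg (x₂ - x₃), sq_nonneg (x₂ - x₄), sq_nonneg (x₃ - x₄)]
  refine (pow_le_pow_left₀ (norm_nonneg _) hnorm 2).trans ((four _ _ _ _).trans (le_of_eq ?_))
  simp only [mul_pow, s1, s2, s3]
  ring

/-- The localized norm of weight `d` is controlled by `P` and by the lower localized norms, provided
the coefficients oscillate little on `K`. -/
theorem exists_mass_top_le [FiniteDimensional ℂ E] [FiniteDimensional ℂ F] {p d : ℕ} (hd : 1 ≤ d)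
    {b : (Fin n → ℕ) → E →L[ℂ] F}
    (hb : ∀ η : Fin n → ℝ, η ≠ 0 → (constSymbol p d b η).IsInvertible) :
    ∃ δ : ℝ, 0 < δ ∧ ∀ (χ : EuclideanSpace ℝ (Fin n) → ℝ) (K : Set (EuclideanSpace ℝ (Fin n)))
      (a : (Fin n → ℕ) → EuclideanSpace ℝ (Fin n) → E →L[ℂ] F), IsCutoff χ K →
      (∀ α ∈ multiIndices n p d, ContinuousOn (a α) K) →
      (∀ α ∈ multiIndices n p d, ∀ y ∈ K, ‖a α y - b α‖ ≤ δ) →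
      ∃ C : ℝ, 0 ≤ C ∧ ∀ v : EuclideanSpace ℝ (Fin n) → E, ContDiff ℝ ∞ v →
        mass p χ K v d ≤
          C * (∫ y in K, ‖∑ α ∈ multiIndices n p d, a α y (wordDeriv (wordOf α) v y)‖ ^ 2) +
          C * ∑ j ∈ Finset.range d, mass p χ K v j := by
  obtain ⟨C₀, hC₀, hF⟩ := exists_integral_norm_wordDeriv_sq_le hd hb
  set N : ℝ := ((multiIndices n p d).card : ℝ) with hN
  set Nw : ℝ := ((words n p d).card : ℝ) with hNw
  -- `δ` is chosen so small that the terms of weight `d` can be absorbed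
  set Q : ℝ := Nw * (2 * C₀ * (4 * N ^ 2)) with hQ
  have hQ0 : 0 ≤ Q := by positivity
  refine ⟨1 / (2 * (Q + 1)), by positivity, fun χ K a hχ ha hδ => ?_⟩
  set δ : ℝ := 1 / (2 * (Q + 1)) with hδdef
  have hδ0 : 0 < δ := by positivity
  have hQδ : Q * δ ^ 2 ≤ 1 / 2 := by
    rw [hδdef, div_pow, mul_div_assoc', div_le_div_iff₀ (by positivity) (by norm_num)]
    nlinarith
  obtain ⟨M, hM0, hMa, hMb⟩ : ∃ M : ℝ, 0 ≤ M ∧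
      (∀ α ∈ multiIndices n p d, ∀ y ∈ K, ‖a α y‖ ≤ M) ∧
      ∀ α ∈ multiIndices n p d, ‖b α‖ ≤ M := by
    refine ⟨∑ α ∈ multiIndices n p d, ‖b α‖ + δ, by positivity, fun α hα y hy => ?_, fun α hα => ?_⟩
    all_goals have h1 := Finset.single_le_sum (f := fun α => ‖b α‖) (fun _ _ => norm_nonneg _) hα
    · have h2 : ‖a α y‖ ≤ ‖a α y - b α‖ + ‖b α‖ := by simpa using norm_add_le (a α y - b α) (b α)
      have h3 := hδ α hα y hy
      linarith
    · linarith
  obtain ⟨C₁, hC₁, hL⟩ := exists_norm_wordDeriv_smul_sub_sq_le (E := E) hχ p d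
  obtain ⟨C₂, hC₂, hP⟩ := exists_norm_frozen_sq_le hχ hδ0.le hM0 hδ hMa hMb
  refine ⟨2 * (Nw * (2 * C₀ * 4) + Nw * (2 * C₀ * C₂ + 2 * C₁)), by positivity, fun v hv => ?_⟩
  set f : EuclideanSpace ℝ (Fin n) → E := fun y => χ y ^ d • v y with hf
  have hfs : ContDiff ℝ ∞ f := (hχ.smooth.pow d).smul hv
  have hft : tsupport f ⊆ K := by
    have hs : Function.support f ⊆ Function.support χ := fun y hy hy' => hy (by
      simp only [hf, hy']
      rw [zero_pow (by omega), zero_smul])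
    exact (closure_mono hs).trans hχ.tsupport_subset
  have hfc : HasCompactSupport f := hχ.isCompact.of_isClosed_subset (isClosed_tsupport f) hft
  have hI : ∀ f : EuclideanSpace ℝ (Fin n) → ℝ, Continuous f → IntegrableOn f K := fun f hf =>
    hf.continuousOn.integrableOn_compact hχ.isCompact
  have hcχ := hχ.smooth.continuous
  have hcw : ∀ w, Continuous (wordDeriv w v) := fun w => (contDiff_wordDeriv w hv).continuous
  have hcf : ∀ w, Continuous (wordDeriv w f) := fun w => (contDiff_wordDeriv w hfs).continuous
  set low : EuclideanSpace ℝ (Fin n) → ℝ := fun y =>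
    ∑ w ∈ lowWords n p d, (χ y ^ wordWeight p w * ‖wordDeriv w v y‖) ^ 2 with hlow
  set top : EuclideanSpace ℝ (Fin n) → ℝ := fun y =>
    ∑ w ∈ words n p d, (χ y ^ d * ‖wordDeriv w v y‖) ^ 2 with htop
  have hclow : Continuous low := by fun_prop
  have hctop : Continuous top := by fun_prop
  have hilow : ∫ y in K, low y = ∑ j ∈ Finset.range d, mass p χ K v j := by
    rw [integral_finsetSum _ fun w _ => hI _ (by fun_prop),
      sum_lowWords fun w => ∫ y in K, (χ y ^ wordWeight p w * ‖wordDeriv w v y‖) ^ 2]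
    refine Finset.sum_congr rfl fun j _ => Finset.sum_congr rfl fun w hw => ?_
    rw [mem_words.1 hw]
  have hitop : ∫ y in K, top y = mass p χ K v d :=
    integral_finsetSum _ fun w _ => hI _ (by fun_prop)
  set Pv : EuclideanSpace ℝ (Fin n) → F := fun y =>
    ∑ α ∈ multiIndices n p d, a α y (wordDeriv (wordOf α) v y) with hPv
  have hPc : ContinuousOn Pv K :=
    continuousOn_finsetSum _ fun α hα => (ha α hα).clm_apply (hcw _).continuousOn
  have hPi : IntegrableOn (fun y => ‖Pv y‖ ^ 2) K :=
    (hPc.norm.pow 2).integrableOn_compact hχ.isCompact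
  set G : EuclideanSpace ℝ (Fin n) → F := fun y =>
    ∑ α ∈ (multiIndices n p d).filter (fun α => weight p α = d),
      b α (wordDeriv (wordOf α) f y) with hG
  have hGc : Continuous G := continuous_finsetSum _ fun α _ => (b α).continuous.comp (hcf _)
  have hG0 : ∀ y, y ∉ K → G y = 0 := fun y hy => Finset.sum_eq_zero fun α _ => by
    rw [image_eq_zero_of_notMem_tsupport fun h => hy (hft (tsupport_wordDeriv_subset _ f h)),
      map_zero]
  have hGK : ∫ y, ‖G y‖ ^ 2 = ∫ y in K, ‖G y‖ ^ 2 :=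
    (setIntegral_eq_integral_of_forall_compl_eq_zero fun y hy => by simp [hG0 y hy]).symm
  have hGle : ∫ y in K, ‖G y‖ ^ 2 ≤ 4 * (∫ y in K, ‖Pv y‖ ^ 2) +
      4 * (N * δ) ^ 2 * mass p χ K v d + C₂ * ∑ j ∈ Finset.range d, mass p χ K v j := by
    have i₁ : IntegrableOn (fun y => 4 * ‖Pv y‖ ^ 2 + 4 * (N * δ) ^ 2 * top y) K :=
      (hPi.const_mul 4).add ((hI _ hctop).const_mul _)
    rw [← hitop, ← hilow, ← integral_const_mul, ← integral_const_mul, ← integral_const_mul,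
      ← integral_add (hPi.const_mul 4) ((hI _ hctop).const_mul _),
      ← integral_add i₁ ((hI _ hclow).const_mul _)]
    exact setIntegral_mono_on (hI _ (by fun_prop)) (i₁.add ((hI _ hclow).const_mul _))
      hχ.isCompact.measurableSet fun y hy => hP v hv y hy
  have hword : ∀ w ∈ words n p d, ∫ y in K, (χ y ^ d * ‖wordDeriv w v y‖) ^ 2 ≤
      2 * C₀ * (∫ y in K, ‖G y‖ ^ 2) + 2 * C₁ * ∑ j ∈ Finset.range d, mass p χ K v j := by
    intro w hw
    have hw := mem_words.1 hw
    have h1 : ∫ y in K, ‖wordDeriv w f y‖ ^ 2 ≤ C₀ * ∫ y in K, ‖G y‖ ^ 2 := by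
      rw [← hGK]
      refine le_trans (le_of_eq ?_) (hF w hw f hfs hfc)
      refine setIntegral_eq_integral_of_forall_compl_eq_zero fun y hy => ?_
      rw [image_eq_zero_of_notMem_tsupport fun h => hy (hft (tsupport_wordDeriv_subset _ f h))]
      simp
    calc _ ≤ ∫ y in K, (2 * ‖wordDeriv w f y‖ ^ 2 + 2 * C₁ * low y) := by
          refine setIntegral_mono_on (hI _ (by fun_prop)) (hI _ (by fun_prop))
            hχ.isCompact.measurableSet fun y hy => ?_
          have h2 := hL w hw v hv y hy
          have h3 : χ y ^ d * ‖wordDeriv w v y‖ ≤ ‖wordDeriv w f y‖ +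
              ‖wordDeriv w f y - χ y ^ d • wordDeriv w v y‖ := by
            have := norm_sub_le (wordDeriv w f y) (wordDeriv w f y - χ y ^ d • wordDeriv w v y)
            rwa [sub_sub_cancel, norm_smul,
              Real.norm_of_nonneg (pow_nonneg (hχ.nonneg y) d)] at this
          have h4 := pow_le_pow_left₀
            (mul_nonneg (pow_nonneg (hχ.nonneg y) d) (norm_nonneg _)) h3 2
          nlinarith [sq_nonneg (‖wordDeriv w f y‖ -
            ‖wordDeriv w f y - χ y ^ d • wordDeriv w v y‖)]
      _ = 2 * (∫ y in K, ‖wordDeriv w f y‖ ^ 2) +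
            2 * C₁ * ∑ j ∈ Finset.range d, mass p χ K v j := by
          rw [integral_add (hI _ (by fun_prop)) (hI _ (by fun_prop)), integral_const_mul,
            integral_const_mul, hilow]
      _ ≤ _ := by linarith
  have hsum : mass p χ K v d ≤ Nw * (2 * C₀ * (∫ y in K, ‖G y‖ ^ 2) +
      2 * C₁ * ∑ j ∈ Finset.range d, mass p χ K v j) := by
    rw [hNw, ← nsmul_eq_mul]
    exact Finset.sum_le_card_nsmul _ _ _ hword
  set low' := ∑ j ∈ Finset.range d, mass p χ K v j with hlow'
  have hlow0 : 0 ≤ low' := Finset.sum_nonneg fun j _ => mass_nonneg _ _ _ _ _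
  have hPv0 : 0 ≤ ∫ y in K, ‖Pv y‖ ^ 2 := integral_nonneg fun y => by positivity
  have htop0 := mass_nonneg p χ K v d
  have hfin : mass p χ K v d ≤ Nw * (2 * C₀ * 4) * (∫ y in K, ‖Pv y‖ ^ 2) +
      Q * δ ^ 2 * mass p χ K v d + Nw * (2 * C₀ * C₂ + 2 * C₁) * low' := by
    refine hsum.trans ?_
    have : Nw * (2 * C₀ * (∫ y in K, ‖G y‖ ^ 2) + 2 * C₁ * low') ≤
        Nw * (2 * C₀ * (4 * (∫ y in K, ‖Pv y‖ ^ 2) +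
          4 * (N * δ) ^ 2 * mass p χ K v d + C₂ * low') + 2 * C₁ * low') := by
      gcongr
    refine this.trans (le_of_eq ?_)
    rw [hQ]; ring
  have habs := mul_le_mul_of_nonneg_right hQδ htop0
  have e1 : 0 ≤ Nw * (2 * C₀ * 4) * low' := by positivity
  have e2 : 0 ≤ Nw * (2 * C₀ * C₂ + 2 * C₁) * (∫ y in K, ‖Pv y‖ ^ 2) := by positivity
  linarith

/-- The interior estimate for operators between trivial bundles with Hermitian fibres. -/
theorem exists_interior_estimate_inner [FiniteDimensional ℂ E] [FiniteDimensional ℂ F] {p d : ℕ}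
    (hd : 1 ≤ d) {Ω : Set (EuclideanSpace ℝ (Fin n))} (hΩ : IsOpen Ω)
    {y₀ : EuclideanSpace ℝ (Fin n)} (hy₀ : y₀ ∈ Ω)
    {a : (Fin n → ℕ) → EuclideanSpace ℝ (Fin n) → E →L[ℂ] F}
    (ha : ∀ α ∈ multiIndices n p d, ContinuousOn (a α) Ω)
    (hσ : ∀ η : Fin n → ℝ, η ≠ 0 → (constSymbol p d (fun α => a α y₀) η).IsInvertible) :
    ∃ R : ℝ, 0 < R ∧ Metric.closedBall y₀ (2 * R) ⊆ Ω ∧ ∃ C : ℝ, 0 ≤ C ∧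
      ∀ v : EuclideanSpace ℝ (Fin n) → E, ContDiff ℝ ∞ v → ∀ α ∈ multiIndices n p d,
        ∫ y in Metric.ball y₀ (R / 2), ‖multiDeriv α v y‖ ^ 2 ≤
          C * ((∫ y in Metric.closedBall y₀ R,
              ‖∑ α ∈ multiIndices n p d, a α y (multiDeriv α v y)‖ ^ 2) +
            ∫ y in Metric.closedBall y₀ R, ‖v y‖ ^ 2) := by
  obtain ⟨δ, hδ, hmain⟩ := exists_mass_top_le hd hσ
  have hev : ∀ᶠ y in nhds y₀, y ∈ Ω ∧ ∀ α ∈ multiIndices n p d, ‖a α y - a α y₀‖ ≤ δ := by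
    refine Filter.Eventually.and (hΩ.mem_nhds hy₀)
      ((Filter.eventually_all_finset _).2 fun α hα => ?_)
    have h1 : ContinuousAt (fun y => a α y - a α y₀) y₀ :=
      ((ha α hα).continuousAt (hΩ.mem_nhds hy₀)).sub continuousAt_const
    have h2 := h1.norm
    refine (h2.eventually_lt continuousAt_const (by simpa using hδ)).mono fun y hy => hy.le
  obtain ⟨R', hR', hRs'⟩ := Metric.nhds_basis_closedBall.eventually_iff.1 hev
  obtain ⟨R, hR, rfl⟩ : ∃ R : ℝ, 0 < R ∧ R' = 2 * R := ⟨R' / 2, by positivity, by ring⟩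
  have hRs : ∀ y ∈ Metric.closedBall y₀ R, y ∈ Ω ∧ ∀ α ∈ multiIndices n p d,
      ‖a α y - a α y₀‖ ≤ δ := fun y hy =>
    hRs' (Metric.closedBall_subset_closedBall (by linarith) hy)
  obtain ⟨χ, hχ, hχ1⟩ := ball_cutoff (y₀ := y₀) hR
  refine ⟨R, hR, fun y hy => (hRs' hy).1, ?_⟩
  set K := Metric.closedBall y₀ R with hK
  obtain ⟨C, hC, hCv⟩ := hmain χ K a hχ (fun α hα => (ha α hα).mono fun y hy => (hRs y hy).1)
    fun α hα y hy => (hRs y hy).2 α hα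
  rcases exists_letter_or_subsingleton hσ with hw | hE
  swap
  · refine ⟨0, le_rfl, fun v _ α _ => ?_⟩
    have : ∀ x : E, ‖x‖ = 0 := fun x => by rw [Subsingleton.elim x 0, norm_zero]
    simp [this]
  let _ : InnerProductSpace ℝ E := InnerProductSpace.rclikeToReal ℂ E
  -- `ε` is such that `C ε ≤ 1 / 2`, which lets the norm of weight `d` be absorbed
  obtain ⟨C', hC', hCv'⟩ := exists_sum_mass_le (E := E) hd hχ hw
    (ε := 1 / (2 * (C + 1))) (by positivity)
  refine ⟨4 * C + (2 * C + 1) * C' * 2, by positivity, fun v hv α hα => ?_⟩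
  have h1 := hCv v hv
  have h2 := hCv' v hv
  simp only [multiDeriv_eq_wordDeriv]
  set A := ∫ y in K, ‖∑ α ∈ multiIndices n p d, a α y (wordDeriv (wordOf α) v y)‖ ^ 2 with hA
  set B := ∫ y in K, ‖v y‖ ^ 2 with hB
  set T := mass p χ K v d with hT
  set L := ∑ j ∈ Finset.range d, mass p χ K v j with hL
  have hA0 : 0 ≤ A := integral_nonneg fun y => by positivity
  have hB0 : 0 ≤ B := integral_nonneg fun y => by positivity
  have hT0 : 0 ≤ T := mass_nonneg _ _ _ _ _
  have hle : ∫ y in Metric.ball y₀ (R / 2), ‖wordDeriv (wordOf α) v y‖ ^ 2 ≤ L + T := by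
    set k := wordWeight p (wordOf α) with hk
    have hkd : k ≤ d := by rw [hk, wordWeight_wordOf]; exact mem_multiIndices.1 hα
    have hsub : Metric.ball y₀ (R / 2) ⊆ K :=
      Metric.ball_subset_closedBall.trans (Metric.closedBall_subset_closedBall (by linarith))
    have hc : Continuous fun y => (χ y ^ k * ‖wordDeriv (wordOf α) v y‖) ^ 2 :=
      ((hχ.smooth.continuous.pow k).mul (contDiff_wordDeriv _ hv).continuous.norm).pow 2
    calc _ = ∫ y in Metric.ball y₀ (R / 2), (χ y ^ k * ‖wordDeriv (wordOf α) v y‖) ^ 2 :=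
          setIntegral_congr_fun Metric.isOpen_ball.measurableSet fun y hy => by
            simp [hχ1 y (Metric.ball_subset_closedBall hy)]
      _ ≤ ∫ y in K, (χ y ^ k * ‖wordDeriv (wordOf α) v y‖) ^ 2 :=
          setIntegral_mono_set (hc.continuousOn.integrableOn_compact hχ.isCompact)
            (Filter.Eventually.of_forall fun y => by positivity) hsub.eventuallyLE
      _ ≤ mass p χ K v k := integral_le_mass rfl
      _ ≤ ∑ j ∈ Finset.range (d + 1), mass p χ K v j :=
          Finset.single_le_sum (f := fun j => mass p χ K v j) (fun j _ => mass_nonneg _ _ _ _ _)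
            (Finset.mem_range.2 (by omega))
      _ = _ := by rw [Finset.sum_range_succ]
  have h3 : C * (1 / (2 * (C + 1)) * T) ≤ T / 2 := by
    have : C * (1 / (2 * (C + 1))) ≤ 1 / 2 := by
      rw [mul_one_div, div_le_div_iff₀ (by positivity) (by norm_num)]; linarith
    calc _ = C * (1 / (2 * (C + 1))) * T := by ring
      _ ≤ 1 / 2 * T := by gcongr
      _ = _ := by ring
  have h4 : 1 / (2 * (C + 1)) * T ≤ T := by
    refine mul_le_of_le_one_left hT0 ?_
    rw [div_le_one (by positivity)]; linarith
  have h5 : T ≤ 2 * C * A + 2 * C * (C' * B) := by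
    have := mul_le_mul_of_nonneg_left h2 hC
    linarith
  have e1 : 0 ≤ C * (C' * B) := by positivity
  have e2 : 0 ≤ C' * A := by positivity
  have e3 : 0 ≤ C * (C' * A) := by positivity
  have e4 : 0 ≤ C * B := by positivity
  have e5 : 0 ≤ C' * B := by positivity
  nlinarith

end Interior

section InteriorGeneral

variable {n : ℕ} {E : Type*} [NormedAddCommGroup E] [NormedSpace ℂ E] [FiniteDimensional ℂ E]
  {F : Type*} [NormedAddCommGroup F] [NormedSpace ℂ F] [FiniteDimensional ℂ F]

theorem wordOf_eq_nil {p : ℕ} {α : Fin n → ℕ} (hα : weight p α = 0) : wordOf α = [] := by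
  rw [← wordWeight_wordOf] at hα
  have := length_le_wordWeight p (wordOf α)
  exact List.length_eq_zero_iff.1 (by omega)

/-- The interior estimate. The fibres are identified with Euclidean spaces, and the function is
extended from a neighbourhood of the ball to all of `ℝⁿ` by a cut-off. -/
theorem exists_interior_estimate {p d : ℕ} {Ω : Set (EuclideanSpace ℝ (Fin n))} (hΩ : IsOpen Ω)
    {y₀ : EuclideanSpace ℝ (Fin n)} (hy₀ : y₀ ∈ Ω)
    {a : (Fin n → ℕ) → EuclideanSpace ℝ (Fin n) → E →L[ℂ] F}
    (ha : ∀ α ∈ multiIndices n p d, ContinuousOn (a α) Ω)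
    (hσ : ∀ η : EuclideanSpace ℝ (Fin n), η ≠ 0 → (localSymbol p d a y₀ η).IsInvertible) :
    ∃ R : ℝ, 0 < R ∧ Metric.closedBall y₀ R ⊆ Ω ∧ ∃ C : ℝ, 0 ≤ C ∧
      ∀ v : EuclideanSpace ℝ (Fin n) → E, ContDiffOn ℝ ∞ v Ω → ∀ α ∈ multiIndices n p d,
        IntegrableOn (fun y => ‖multiDeriv α v y‖ ^ 2) (Metric.ball y₀ (R / 2)) ∧
        ∫ y in Metric.ball y₀ (R / 2), ‖multiDeriv α v y‖ ^ 2 ≤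
          C * ((∫ y in Metric.closedBall y₀ R,
              ‖∑ α ∈ multiIndices n p d, a α y (multiDeriv α v y)‖ ^ 2) +
            ∫ y in Metric.closedBall y₀ R, ‖v y‖ ^ 2) := by
  rcases Nat.eq_zero_or_pos d with rfl | hd
  -- in degree zero `∂^α v = v`, and the symbol plays no role
  · obtain ⟨R, hR, hRs⟩ := Metric.nhds_basis_closedBall.mem_iff.1 (hΩ.mem_nhds hy₀)
    refine ⟨R, hR, hRs, 1, zero_le_one, fun v hv α hα => ?_⟩
    have hα0 : weight p α = 0 := Nat.le_zero.1 (mem_multiIndices.1 hα)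
    have hD : multiDeriv α v = v := by
      rw [multiDeriv_eq_wordDeriv, wordOf_eq_nil hα0, wordDeriv_nil]
    have hsub : Metric.ball y₀ (R / 2) ⊆ Metric.closedBall y₀ R :=
      Metric.ball_subset_closedBall.trans (Metric.closedBall_subset_closedBall (by linarith))
    have hi : IntegrableOn (fun y => ‖v y‖ ^ 2) (Metric.closedBall y₀ R) :=
      ((hv.continuousOn.mono hRs).norm.pow 2).integrableOn_compact (isCompact_closedBall _ _)
    rw [hD]
    refine ⟨hi.mono_set hsub, ?_⟩
    rw [one_mul]
    refine (setIntegral_mono_set hi (Filter.Eventually.of_forall fun y => by positivity)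
      hsub.eventuallyLE).trans (le_add_of_nonneg_left (integral_nonneg fun y => by positivity))
  obtain ⟨N, ⟨LE⟩⟩ : ∃ N, Nonempty (E ≃L[ℂ] EuclideanSpace ℂ (Fin N)) :=
    ⟨_, ⟨ContinuousLinearEquiv.ofFinrankEq (finrank_euclideanSpace_fin (𝕜 := ℂ)).symm⟩⟩
  obtain ⟨N', ⟨LF⟩⟩ : ∃ N, Nonempty (F ≃L[ℂ] EuclideanSpace ℂ (Fin N)) :=
    ⟨_, ⟨ContinuousLinearEquiv.ofFinrankEq (finrank_euclideanSpace_fin (𝕜 := ℂ)).symm⟩⟩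
  let TE : E →L[ℂ] EuclideanSpace ℂ (Fin N) := LE
  let TE' : EuclideanSpace ℂ (Fin N) →L[ℂ] E := LE.symm
  let TF : F →L[ℂ] EuclideanSpace ℂ (Fin N') := LF
  let a' : (Fin n → ℕ) → EuclideanSpace ℝ (Fin n) → EuclideanSpace ℂ (Fin N) →L[ℂ]
      EuclideanSpace ℂ (Fin N') := fun α y =>
    TF.comp ((a α y).comp TE')
  have ha' : ∀ α ∈ multiIndices n p d, ContinuousOn (a' α) Ω := fun α hα =>
    continuousOn_const.clm_comp ((ha α hα).clm_comp continuousOn_const)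
  have hσ' : ∀ η : Fin n → ℝ, η ≠ 0 →
      (constSymbol p d (fun α => a' α y₀) η).IsInvertible := by
    intro η hη
    obtain ⟨e, he⟩ := hσ (WithLp.toLp 2 η) (by simpa using hη)
    refine ⟨(LE.symm.trans e).trans LF, ?_⟩
    ext1 z
    have h1 := congrArg (fun L : E →L[ℂ] F => LF (L (LE.symm z))) he
    simp only [localSymbol, _root_.sum_apply, _root_.smul_apply, map_sum, map_smul] at h1
    simpa [constSymbol, a', TE', TF, _root_.sum_apply] using h1
  obtain ⟨R, hR, hRs, C, hC, hmain⟩ := exists_interior_estimate_inner hd hΩ hy₀ ha' hσ'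
  have hRΩ : Metric.closedBall y₀ R ⊆ Ω :=
    (Metric.closedBall_subset_closedBall (by linarith)).trans hRs
  refine ⟨R, hR, hRΩ, ‖TE'‖ ^ 2 *
    (C * (‖TF‖ ^ 2 + ‖TE‖ ^ 2)), by positivity, fun v hv α hα => ?_⟩
  -- the bump equals one near the closed ball of radius `R`, where the derivatives are compared
  let f : ContDiffBump y₀ := ⟨3 / 2 * R, 2 * R, by positivity, by linarith⟩
  set v' : EuclideanSpace ℝ (Fin n) → E := fun y => f y • v y with hv'
  have hv's : ContDiff ℝ ∞ v' := by
    rw [← contMDiff_iff_contDiff]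
    refine contMDiff_of_tsupport fun y hy => ContDiffAt.contMDiffAt ?_
    have hy' : y ∈ Ω := hRs (by
      have := closure_mono (Function.support_smul_subset_left (⇑f) v) hy
      rw [← tsupport, f.tsupport_eq] at this
      exact this)
    exact f.contDiffAt.smul ((hv y hy').contDiffAt (hΩ.mem_nhds hy'))
  have hvv' : ∀ y ∈ Metric.closedBall y₀ R, v' =ᶠ[nhds y] v := by
    intro y hy
    have : Metric.ball y₀ (3 / 2 * R) ∈ nhds y := Metric.isOpen_ball.mem_nhds
      (Metric.closedBall_subset_ball (by linarith) hy)
    filter_upwards [this] with z hz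
    rw [hv']
    simp only
    rw [f.one_of_mem_closedBall (Metric.ball_subset_closedBall hz), one_smul]
  have hD : ∀ β, ∀ y ∈ Metric.closedBall y₀ R, multiDeriv β v y = wordDeriv (wordOf β) v' y := by
    intro β y hy
    rw [multiDeriv_eq_wordDeriv]
    exact (wordDeriv_congr_of_eventuallyEq _ (hvv' y hy)).symm.eq_of_nhds
  have hDL : ∀ β y, multiDeriv β (fun y => LE (v' y)) y = LE (wordDeriv (wordOf β) v' y) := by
    intro β y
    rw [multiDeriv_eq_wordDeriv]
    exact congrFun (wordDeriv_clm_comp (TE.restrictScalars ℝ) _ hv's) y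
  have hcD : ∀ β, Continuous (wordDeriv (wordOf β) v') := fun β =>
    (contDiff_wordDeriv _ hv's).continuous
  have hsub : Metric.ball y₀ (R / 2) ⊆ Metric.closedBall y₀ R :=
    Metric.ball_subset_closedBall.trans (Metric.closedBall_subset_closedBall (by linarith))
  have hKm : MeasurableSet (Metric.closedBall y₀ R) := Metric.isClosed_closedBall.measurableSet
  have hI : ∀ g : EuclideanSpace ℝ (Fin n) → ℝ, ContinuousOn g (Metric.closedBall y₀ R) →
      IntegrableOn g (Metric.closedBall y₀ R) := fun g hg =>
    hg.integrableOn_compact (isCompact_closedBall _ _)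
  have hcP : ContinuousOn (fun y => ∑ β ∈ multiIndices n p d, a β y (multiDeriv β v y))
      (Metric.closedBall y₀ R) := by
    refine continuousOn_finsetSum _ fun β hβ => ((ha β hβ).mono hRΩ).clm_apply ?_
    exact (hcD β).continuousOn.congr fun y hy => hD β y hy
  have hcv : ContinuousOn v (Metric.closedBall y₀ R) := hv.continuousOn.mono hRΩ
  have hest := hmain (fun y => LE (v' y))
    ((TE.restrictScalars ℝ).contDiff.comp hv's) α hα
  have hcα : ContinuousOn (fun y => ‖multiDeriv α v y‖ ^ 2) (Metric.closedBall y₀ R) :=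
    ((hcD α).continuousOn.congr fun y hy => hD α y hy).norm.pow 2
  refine ⟨(hI _ hcα).mono_set hsub, ?_⟩
  have s1 : ∫ y in Metric.ball y₀ (R / 2), ‖multiDeriv α v y‖ ^ 2 ≤
      ‖TE'‖ ^ 2 *
        ∫ y in Metric.ball y₀ (R / 2), ‖multiDeriv α (fun y => LE (v' y)) y‖ ^ 2 := by
    rw [← integral_const_mul]
    simp only [hDL]
    refine setIntegral_mono_on ((hI _ hcα).mono_set hsub)
      ((hI _ (Continuous.continuousOn ?_)).mono_set hsub)
      Metric.isOpen_ball.measurableSet fun y hy => ?_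
    · exact continuous_const.mul ((LE.continuous.comp (hcD α)).norm.pow 2)
    · rw [← mul_pow, hD α y (hsub hy)]
      gcongr
      simpa [TE'] using TE'.le_opNorm (LE (wordDeriv (wordOf α) v' y))
  have s2 : ∫ y in Metric.closedBall y₀ R,
      ‖∑ β ∈ multiIndices n p d, a' β y (multiDeriv β (fun y => LE (v' y)) y)‖ ^ 2 ≤
      ‖TF‖ ^ 2 * ∫ y in Metric.closedBall y₀ R,
        ‖∑ β ∈ multiIndices n p d, a β y (multiDeriv β v y)‖ ^ 2 := by
    rw [← integral_const_mul]
    refine integral_mono_of_nonneg (Filter.Eventually.of_forall fun y => by positivity)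
      (hI _ (continuousOn_const.mul (hcP.norm.pow 2)))
      ((ae_restrict_iff' hKm).2 (Filter.Eventually.of_forall fun y hy => ?_))
    have : ∑ β ∈ multiIndices n p d, a' β y (multiDeriv β (fun y => LE (v' y)) y) =
        LF (∑ β ∈ multiIndices n p d, a β y (multiDeriv β v y)) := by
      rw [map_sum]
      refine Finset.sum_congr rfl fun β _ => ?_
      rw [hDL, hD β y hy]
      simp [a', TE', TF]
    simp only [this]
    rw [← mul_pow]
    gcongr
    exact TF.le_opNorm _
  have s3 : ∫ y in Metric.closedBall y₀ R, ‖LE (v' y)‖ ^ 2 ≤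
      ‖TE‖ ^ 2 * ∫ y in Metric.closedBall y₀ R, ‖v y‖ ^ 2 := by
    rw [← integral_const_mul]
    refine integral_mono_of_nonneg (Filter.Eventually.of_forall fun y => by positivity)
      (hI _ (continuousOn_const.mul (hcv.norm.pow 2)))
      ((ae_restrict_iff' hKm).2 (Filter.Eventually.of_forall fun y hy => ?_))
    simp only [(hvv' y hy).eq_of_nhds]
    rw [← mul_pow]
    gcongr
    exact TE.le_opNorm _
  set A := ∫ y in Metric.closedBall y₀ R,
        ‖∑ β ∈ multiIndices n p d, a β y (multiDeriv β v y)‖ ^ 2 with hA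
  set B := ∫ y in Metric.closedBall y₀ R, ‖v y‖ ^ 2 with hB
  have hA0 : 0 ≤ A := integral_nonneg fun y => by positivity
  have hB0 : 0 ≤ B := integral_nonneg fun y => by positivity
  refine s1.trans ?_
  rw [mul_assoc]
  refine mul_le_mul_of_nonneg_left (hest.trans ?_) (by positivity)
  rw [mul_assoc]
  refine mul_le_mul_of_nonneg_left ((add_le_add s2 s3).trans ?_) hC
  have e1 : 0 ≤ ‖TF‖ ^ 2 * B := by positivity
  have e2 : 0 ≤ ‖TE‖ ^ 2 * A := by positivity
  linarith

end InteriorGeneral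

/-! ### Hermitian metrics in local trivializations -/

section Hermitian

variable {n : ℕ} {M : Type*} [TopologicalSpace M] [ChartedSpace (EuclideanSpace ℝ (Fin n)) M]
  {E : Type*} [NormedAddCommGroup E] [NormedSpace ℂ E]
  {V : M → Type*} [TopologicalSpace (TotalSpace E V)] [∀ x, TopologicalSpace (V x)]
  [∀ x, AddCommGroup (V x)] [∀ x, Module ℂ (V x)]
  [FiberBundle E V]

/-- Every vector of the model fibre extends to a smooth section that is constant, in a given
trivialization, near a given point. -/
theorem exists_section_eventually_eq_symm [IsManifold (𝓡 n) ∞ M] [T2Space M]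
    [VectorBundle ℝ E V] [ContMDiffVectorBundle ∞ E V (𝓡 n)]
    (e : Trivialization E (π E V)) [MemTrivializationAtlas e] {x₀ : M} (hx₀ : x₀ ∈ e.baseSet)
    (z : E) :
    ∃ s : Cₛ^∞⟮𝓡 n; E, V⟯, ∀ᶠ x in nhds x₀, s x = e.symm x z := by
  obtain ⟨f, -, hf⟩ := (SmoothBumpFunction.nhds_basis_tsupport (I := 𝓡 n) x₀).mem_iff.1
    (e.open_baseSet.mem_nhds hx₀)
  have hs : ContMDiffOn (𝓡 n) ((𝓡 n).prod 𝓘(ℝ, E)) ∞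
      (fun x => TotalSpace.mk' E x (e.symm x z)) e.baseSet := by
    rw [e.contMDiffOn_section_baseSet_iff]
    refine (contMDiffOn_const (c := z)).congr fun x hx => ?_
    rw [e.apply_mk_symm hx]
  refine ⟨⟨_, ContMDiffOn.smul_section_of_tsupport f.contMDiff.contMDiffOn e.open_baseSet hf hs⟩,
    ?_⟩
  filter_upwards [f.eventuallyEq_one] with x hx
  change f x • e.symm x z = _
  rw [hx, Pi.one_apply, one_smul]

/-- Near a point, a Hermitian metric in a trivialization is a continuous function of the point and
of the fibre coordinate, quadratic in the latter: it is expressed by the Gram matrix of smooth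
sections that extend a basis. -/
theorem HermitianMetric.exists_local_form [IsManifold (𝓡 n) ∞ M] [T2Space M]
    [FiniteDimensional ℂ E] [VectorBundle ℂ E V] [VectorBundle ℝ E V]
    [ContMDiffVectorBundle ∞ E V (𝓡 n)]
    (h : HermitianMetric n E V) (e : Trivialization E (π E V)) [MemTrivializationAtlas e] {x₀ : M}
    (hx₀ : x₀ ∈ e.baseSet) :
    ∃ g : M → E → ℝ, (Continuous fun q : M × E => g q.1 q.2) ∧
      (∀ x (t : ℝ) z, g x ((t : ℂ) • z) = t ^ 2 * g x z) ∧
      ∀ᶠ x in nhds x₀, x ∈ e.baseSet ∧ ∀ s : V x, (h.form x s s).re = g x (e ⟨x, s⟩).2 := by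
  let b := Module.finBasis ℂ E
  choose S hS using fun i => exists_section_eventually_eq_symm (n := n) e hx₀ (b i)
  -- the metric in the trivialization, as a function of the point and of the fibre coordinate
  set g : M → E → ℝ := fun x z =>
    (∑ i, ∑ j, starRingEnd ℂ (b.repr z i) * (b.repr z j * h.form x (S i x) (S j x))).re with hg
  have hgc : Continuous fun q : M × E => g q.1 q.2 := by
    have h1 : ∀ i, Continuous fun z : E => b.repr z i := fun i =>
      (b.coord i).continuous_of_finiteDimensional
    have h2 : ∀ i j, Continuous fun x => h.form x (S i x) (S j x) := fun i j =>
      (h.smooth (S i) (S j)).continuous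
    refine Complex.continuous_re.comp (continuous_finsetSum _ fun i _ =>
      continuous_finsetSum _ fun j _ => ?_)
    exact (Complex.continuous_conj.comp ((h1 i).comp continuous_snd)).mul
      (((h1 j).comp continuous_snd).mul ((h2 i j).comp continuous_fst))
  have hge : ∀ᶠ x in nhds x₀, x ∈ e.baseSet ∧
      ∀ s : V x, (h.form x s s).re = g x (e ⟨x, s⟩).2 := by
    filter_upwards [e.open_baseSet.mem_nhds hx₀, Filter.eventually_all.2 hS] with x hx hxS
    refine ⟨hx, fun s => ?_⟩
    have hs : s = ∑ i, b.repr (e ⟨x, s⟩).2 i • S i x := by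
      have h1 : s = e.symmₗ ℂ x (e ⟨x, s⟩).2 := by
        rw [e.coe_symmₗ hx]
        exact (e.symm_apply_apply_mk hx s).symm
      have h2 := b.sum_repr (e ⟨x, s⟩).2
      conv_lhs => rw [h1, ← h2, map_sum]
      refine Finset.sum_congr rfl fun i _ => ?_
      rw [map_smul, e.coe_symmₗ hx, hxS i]
    conv_lhs => rw [hs]
    simp only [hg, map_sum, LinearMap.sum_apply, map_smul, LinearMap.map_smulₛₗ,
      LinearMap.smul_apply, smul_eq_mul]
    congr 1
    rw [Finset.sum_comm]
    refine Finset.sum_congr rfl fun i _ => ?_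
    rw [Finset.mul_sum]
    refine Finset.sum_congr rfl fun j _ => ?_
    ring
  have hhom : ∀ x (t : ℝ) z, g x ((t : ℂ) • z) = t ^ 2 * g x z := by
    intro x t z
    simp only [hg, map_smul, Finsupp.smul_apply, smul_eq_mul, map_mul, Complex.conj_ofReal]
    rw [← Complex.re_ofReal_mul, Finset.mul_sum]
    congr 1
    refine Finset.sum_congr rfl fun i _ => ?_
    rw [Finset.mul_sum]
    refine Finset.sum_congr rfl fun j _ => ?_
    push_cast
    ring
  exact ⟨g, hgc, hhom, hge⟩

/-- Near a point, a Hermitian metric is comparable to the norm of the model fibre. -/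
theorem HermitianMetric.eventually_comparable [IsManifold (𝓡 n) ∞ M] [T2Space M]
    [FiniteDimensional ℂ E] [VectorBundle ℂ E V] [VectorBundle ℝ E V]
    [ContMDiffVectorBundle ∞ E V (𝓡 n)]
    (h : HermitianMetric n E V) (e : Trivialization E (π E V)) [MemTrivializationAtlas e] {x₀ : M}
    (hx₀ : x₀ ∈ e.baseSet) :
    ∃ C : ℝ, 0 < C ∧ ∀ᶠ x in nhds x₀, x ∈ e.baseSet ∧ ∀ s : V x,
      ‖(e ⟨x, s⟩).2‖ ^ 2 ≤ C * (h.form x s s).re ∧ (h.form x s s).re ≤ C * ‖(e ⟨x, s⟩).2‖ ^ 2 := by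
  have : ProperSpace E := FiniteDimensional.proper ℂ E
  obtain ⟨g, hgc, hhom, hge⟩ := h.exists_local_form e hx₀
  have hpos : ∀ z ∈ Metric.sphere (0 : E) 1, 0 < g x₀ z := by
    intro z hz
    have h1 := hge.self_of_nhds.2 (e.symm x₀ z)
    rw [e.apply_mk_symm hx₀] at h1
    rw [← h1]
    refine h.pos x₀ _ fun h0 => ?_
    have h2 := e.apply_mk_symm hx₀ z
    have h3 : (e ⟨x₀, (0 : V x₀)⟩).2 = 0 := (e.linear ℂ hx₀).map_zero
    rw [h0] at h2
    rw [h2] at h3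
    simp only at h3
    rw [h3] at hz
    simp at hz
  have hgx₀ : Continuous (g x₀) := hgc.comp (by fun_prop : Continuous fun z : E => (x₀, z))
  obtain ⟨c, hc, hcb⟩ := (isCompact_sphere (0 : E) 1).exists_forall_le' hgx₀.continuousOn hpos
  obtain ⟨B, hB⟩ := (isCompact_sphere (0 : E) 1).exists_bound_of_continuousOn hgx₀.continuousOn
  have hev : ∀ᶠ x in nhds x₀, ∀ z ∈ Metric.sphere (0 : E) 1, c / 2 < g x z ∧ g x z < |B| + 1 := by
    refine (isCompact_sphere (0 : E) 1).eventually_forall_of_forall_eventually fun z hz => ?_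
    have h1 : ContinuousAt (fun q : M × E => g q.1 q.2) (x₀, z) := hgc.continuousAt
    refine (continuousAt_const.eventually_lt h1 ?_).and (h1.eventually_lt continuousAt_const ?_)
    · have := hcb z hz
      simp only
      linarith
    · have := hB z hz
      have h2 := le_abs_self (g x₀ z)
      rw [Real.norm_eq_abs] at this
      have h3 := le_abs_self B
      simp only
      linarith
  refine ⟨2 / c + |B| + 1, by positivity, ?_⟩
  filter_upwards [hge, hev] with x hx hxs
  refine ⟨hx.1, fun s => ?_⟩
  rw [hx.2 s]
  set z := (e ⟨x, s⟩).2 with hz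
  rcases eq_or_ne z 0 with h0 | h0
  · have : g x (0 : E) = 0 := by simpa using hhom x 0 0
    simp [h0, this]
  have hz0 : 0 < ‖z‖ := norm_pos_iff.2 h0
  obtain ⟨h1, h2⟩ := hxs (((‖z‖⁻¹ : ℝ) : ℂ) • z) (by
    simp [norm_smul, inv_mul_cancel₀ hz0.ne'])
  rw [hhom, inv_pow, inv_mul_eq_div] at h1 h2
  rw [lt_div_iff₀ (by positivity)] at h1
  rw [div_lt_iff₀ (by positivity)] at h2
  have hgz : 0 < g x z := lt_trans (by positivity) h1
  constructor
  · have h3 : ‖z‖ ^ 2 ≤ 2 / c * g x z := by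
      rw [div_mul_eq_mul_div, le_div_iff₀ hc]; linarith
    have h4 : 0 ≤ (|B| + 1) * g x z := by positivity
    linarith
  · have h4 : 0 ≤ 2 / c * ‖z‖ ^ 2 := by positivity
    linarith

theorem HermitianMetric.form_self_nonneg (h : HermitianMetric n E V) (x : M) (s : V x) :
    0 ≤ (h.form x s s).re := by
  rcases eq_or_ne s 0 with rfl | hs
  · simp
  · exact (h.pos x s hs).le

theorem HermitianMetric.continuous_form_self (h : HermitianMetric n E V)
    (u : Cₛ^∞⟮𝓡 n; E, V⟯) : Continuous fun x => (h.form x (u x) (u x)).re :=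
  Complex.continuous_re.comp (h.smooth u u).continuous

theorem contDiffOn_localSection [IsManifold (𝓡 n) ∞ M] [VectorBundle ℝ E V]
    [ContMDiffVectorBundle ∞ E V (𝓡 n)]
    {φ : OpenPartialHomeomorph M (EuclideanSpace ℝ (Fin n))}
    (hφ : φ ∈ IsManifold.maximalAtlas (𝓡 n) ∞ M)
    (e : Trivialization E (π E V)) [MemTrivializationAtlas e] (u : Cₛ^∞⟮𝓡 n; E, V⟯)
    {Ω : Set (EuclideanSpace ℝ (Fin n))} (hΩ : Ω ⊆ φ.target)
    (hΩ' : ∀ y ∈ Ω, φ.symm y ∈ e.baseSet) : ContDiffOn ℝ ∞ (localSection φ e u) Ω := by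
  have h1 : ContMDiffOn (𝓡 n) 𝓘(ℝ, E) ∞ (fun x => (e ⟨x, u x⟩).2) e.baseSet :=
    e.contMDiffOn_section_baseSet_iff.1 u.contMDiff.contMDiffOn
  have h2 : ContMDiffOn (𝓡 n) (𝓡 n) ∞ φ.symm φ.target :=
    contMDiffOn_symm_of_mem_maximalAtlas hφ
  exact (h1.comp (h2.mono hΩ) hΩ').contDiffOn

end Hermitian

/-! ### Integration in a chart -/

section Density

variable {n : ℕ} {M : Type*} [TopologicalSpace M] [MeasurableSpace M] [BorelSpace M]

theorem setIntegral_preimage_chart {μ : Measure M}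
    {φ : OpenPartialHomeomorph M (EuclideanSpace ℝ (Fin n))} {ρ : EuclideanSpace ℝ (Fin n) → ℝ}
    (hρ : ContinuousOn ρ φ.target) (hρ0 : ∀ y ∈ φ.target, 0 < ρ y)
    (hμ : (μ.restrict φ.source).map φ =
      (volume.restrict φ.target).withDensity fun y => ENNReal.ofReal (ρ y))
    {B : Set (EuclideanSpace ℝ (Fin n))} (hB : MeasurableSet B) (hBt : B ⊆ φ.target)
    {f : M → ℝ} (hf : Continuous f) :
    ∫ x in φ.source ∩ φ ⁻¹' B, f x ∂μ = ∫ y in B, ρ y * f (φ.symm y) := by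
  have hsm : MeasurableSet φ.source := φ.open_source.measurableSet
  have htm : MeasurableSet φ.target := φ.open_target.measurableSet
  have hφm : AEMeasurable φ (μ.restrict φ.source) := φ.continuousOn.aemeasurable hsm
  have hρm : AEMeasurable ρ (volume.restrict φ.target) := hρ.aemeasurable htm
  have hfs : AEStronglyMeasurable (fun y => f (φ.symm y)) (volume.restrict φ.target) :=
    (hf.comp_continuousOn φ.continuousOn_symm).aestronglyMeasurable htm
  have hfm : AEStronglyMeasurable (fun y => f (φ.symm y)) ((μ.restrict φ.source).map φ) := by
    rw [hμ]
    exact hfs.mono_ac (withDensity_absolutelyContinuous _ _)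
  have h1 := setIntegral_map hB hfm hφm
  have h2 : ∫ x in φ ⁻¹' B, f (φ.symm (φ x)) ∂(μ.restrict φ.source) =
      ∫ x in φ.source ∩ φ ⁻¹' B, f x ∂μ := by
    rw [Measure.restrict_restrict' hsm, Set.inter_comm]
    refine integral_congr_ae ?_
    have h3 : ∀ᵐ x ∂μ.restrict (φ.source ∩ φ ⁻¹' B), x ∈ φ.source :=
      ae_mono (Measure.restrict_mono_set μ Set.inter_subset_left) (ae_restrict_mem hsm)
    filter_upwards [h3] with x hx
    rw [φ.left_inv hx]
  rw [← h2, ← h1, hμ, restrict_withDensity hB, Measure.restrict_restrict hB,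
    Set.inter_eq_left.2 hBt, integral_withDensity_eq_integral_toReal_smul₀]
  · refine setIntegral_congr_fun hB fun y hy => ?_
    simp [ENNReal.toReal_ofReal (hρ0 y (hBt hy)).le]
  · exact (hρm.mono_measure (Measure.restrict_mono_set _ hBt)).ennreal_ofReal
  · exact Filter.Eventually.of_forall fun _ => ENNReal.ofReal_lt_top

theorem measure_preimage_chart_lt_top {μ : Measure M}
    {φ : OpenPartialHomeomorph M (EuclideanSpace ℝ (Fin n))} {ρ : EuclideanSpace ℝ (Fin n) → ℝ}
    (hμ : (μ.restrict φ.source).map φ =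
      (volume.restrict φ.target).withDensity fun y => ENNReal.ofReal (ρ y))
    {B : Set (EuclideanSpace ℝ (Fin n))} (hB : IsCompact B) (hBt : B ⊆ φ.target)
    (hρ : ContinuousOn ρ φ.target) :
    μ (φ.source ∩ φ ⁻¹' B) < ⊤ := by
  have hsm : MeasurableSet φ.source := φ.open_source.measurableSet
  have hφm : AEMeasurable φ (μ.restrict φ.source) := φ.continuousOn.aemeasurable hsm
  have h1 : μ (φ.source ∩ φ ⁻¹' B) = (μ.restrict φ.source).map φ B := by
    rw [Measure.map_apply_of_aemeasurable hφm hB.measurableSet,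
      Measure.restrict_apply' hsm, Set.inter_comm]
  rw [h1, hμ, withDensity_apply _ hB.measurableSet, Measure.restrict_restrict hB.measurableSet,
    Set.inter_eq_left.2 hBt]
  exact ((hρ.mono hBt).integrableOn_compact hB).lintegral_lt_top

end Density

/-! ### From local to global estimates -/

section Global

variable {n : ℕ} {M : Type*} [TopologicalSpace M] [ChartedSpace (EuclideanSpace ℝ (Fin n)) M]
  [IsManifold (𝓡 n) ∞ M] [MeasurableSpace M] [BorelSpace M]

theorem IsSmoothPositiveDensity.isFiniteMeasure [CompactSpace M] {μ : Measure M}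
    (hμ : IsSmoothPositiveDensity n μ) : IsFiniteMeasure μ := by
  refine ⟨isCompact_univ.measure_lt_top_of_nhdsWithin fun x _ => ?_⟩
  set φ := chartAt (EuclideanSpace ℝ (Fin n)) x
  obtain ⟨ρ, hρ, -, hμρ⟩ := hμ φ (IsManifold.chart_mem_maximalAtlas x)
  obtain ⟨R, hR, hRt⟩ := Metric.nhds_basis_closedBall.mem_iff.1
    (φ.open_target.mem_nhds (φ.map_source (mem_chart_source _ x)))
  refine ⟨φ.source ∩ φ ⁻¹' Metric.closedBall (φ x) R, ?_,
    measure_preimage_chart_lt_top hμρ (isCompact_closedBall _ _) hRt hρ.continuousOn⟩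
  rw [nhdsWithin_univ]
  exact Filter.inter_mem (φ.open_source.mem_nhds (mem_chart_source _ x))
    ((φ.continuousAt (mem_chart_source _ x)).preimage_mem_nhds
      (Metric.closedBall_mem_nhds _ hR))

theorem integrable_of_continuous [CompactSpace M] {μ : Measure M}
    (hμ : IsSmoothPositiveDensity n μ) {f : M → ℝ} (hf : Continuous f) : Integrable f μ := by
  have := hμ.isFiniteMeasure
  exact hf.integrable_of_hasCompactSupport (isClosed_tsupport f).isCompact

variable {E : Type*} [NormedAddCommGroup E] [NormedSpace ℂ E]
  {V : M → Type*} [TopologicalSpace (TotalSpace E V)] [∀ x, TopologicalSpace (V x)]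
  [∀ x, AddCommGroup (V x)] [∀ x, Module ℂ (V x)] [FiberBundle E V]

theorem norm_sum_clm_sq_le {X Y ι : Type*} [NormedAddCommGroup X] [NormedSpace ℂ X]
    [NormedAddCommGroup Y] [NormedSpace ℂ Y] (s : Finset ι) {b : ι → X →L[ℂ] Y} {m : ℝ}
    (hb : ∀ α ∈ s, ‖b α‖ ≤ m) (x : ι → X) :
    ‖∑ α ∈ s, b α (x α)‖ ^ 2 ≤ s.card * m ^ 2 * ∑ α ∈ s, ‖x α‖ ^ 2 := by
  calc ‖∑ α ∈ s, b α (x α)‖ ^ 2 ≤ (∑ α ∈ s, m * ‖x α‖) ^ 2 := by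
        gcongr
        exact norm_sum_le_of_le _ fun α hα => (b α).le_of_opNorm_le (hb α hα) _
    _ ≤ s.card * ∑ α ∈ s, (m * ‖x α‖) ^ 2 := sq_sum_le_card_mul_sum_sq
    _ = _ := by simp only [mul_pow, ← Finset.mul_sum]; ring

/-- In a chart where the density and the metric are comparable to the standard ones, the local
`L²` norm of a section is bounded by its global norm. -/
theorem integral_localSection_le [CompactSpace M] {μ : Measure M}
    (hμ : IsSmoothPositiveDensity n μ) (h : HermitianMetric n E V)
    {φ : OpenPartialHomeomorph M (EuclideanSpace ℝ (Fin n))} {ρ : EuclideanSpace ℝ (Fin n) → ℝ}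
    (hρ : ContinuousOn ρ φ.target) (hρ0 : ∀ y ∈ φ.target, 0 < ρ y)
    (hμρ : (μ.restrict φ.source).map φ =
      (volume.restrict φ.target).withDensity fun y => ENNReal.ofReal (ρ y))
    (e : Trivialization E (π E V))
    {K : Set (EuclideanSpace ℝ (Fin n))} (hK : IsCompact K) (hKt : K ⊆ φ.target)
    {c C : ℝ} (hc : 0 < c) (hC : 0 ≤ C) (hcρ : ∀ y ∈ K, c ≤ ρ y)
    (hCh : ∀ y ∈ K, ∀ s : V (φ.symm y),
      ‖(e ⟨φ.symm y, s⟩).2‖ ^ 2 ≤ C * (h.form (φ.symm y) s s).re)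
    (u : Cₛ^∞⟮𝓡 n; E, V⟯) :
    ∫ y in K, ‖localSection φ e u y‖ ^ 2 ≤ C / c * ∫ x, (h.form x (u x) (u x)).re ∂μ := by
  have hf := h.continuous_form_self u
  have hi : IntegrableOn (fun y => ρ y * (h.form (φ.symm y) (u (φ.symm y)) (u (φ.symm y))).re) K :=
    ((hρ.mono hKt).mul (hf.comp_continuousOn
      (φ.continuousOn_symm.mono hKt))).integrableOn_compact hK
  calc ∫ y in K, ‖localSection φ e u y‖ ^ 2
      ≤ ∫ y in K, C / c * (ρ y * (h.form (φ.symm y) (u (φ.symm y)) (u (φ.symm y))).re) := by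
        refine integral_mono_of_nonneg (Filter.Eventually.of_forall fun y => by positivity)
          (hi.const_mul _) ((ae_restrict_iff' hK.measurableSet).2
            (Filter.Eventually.of_forall fun y hy => ?_))
        refine (hCh y hy _).trans ?_
        have h1 := h.form_self_nonneg (φ.symm y) (u (φ.symm y))
        simp only
        rw [div_mul_eq_mul_div, le_div_iff₀ hc]
        have h2 := mul_le_mul_of_nonneg_right (hcρ y hy) (mul_nonneg hC h1)
        linarith
    _ = C / c * ∫ x in φ.source ∩ φ ⁻¹' K, (h.form x (u x) (u x)).re ∂μ := by
        rw [integral_const_mul, setIntegral_preimage_chart hρ hρ0 hμρ hK.measurableSet hKt hf]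
    _ ≤ _ := by
        gcongr
        · exact Filter.Eventually.of_forall fun x => h.form_self_nonneg x (u x)
        · exact integrable_of_continuous hμ hf
        · exact Measure.restrict_le_self

variable [FiniteDimensional ℂ E] [VectorBundle ℂ E V] [VectorBundle ℝ E V]
  [ContMDiffVectorBundle ∞ E V (𝓡 n)]
  {F : Type*} [NormedAddCommGroup F] [NormedSpace ℂ F] [FiniteDimensional ℂ F]
  {W : M → Type*} [TopologicalSpace (TotalSpace F W)] [∀ x, TopologicalSpace (W x)]
  [∀ x, AddCommGroup (W x)] [∀ x, Module ℂ (W x)]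
  [FiberBundle F W] [VectorBundle ℂ F W] [VectorBundle ℝ F W]
  [ContMDiffVectorBundle ∞ F W (𝓡 n)]
  {G : Type*} [NormedAddCommGroup G] [NormedSpace ℂ G] [FiniteDimensional ℂ G]
  {Z : M → Type*} [TopologicalSpace (TotalSpace G Z)] [∀ x, TopologicalSpace (Z x)]
  [∀ x, AddCommGroup (Z x)] [∀ x, Module ℂ (Z x)]
  [FiberBundle G Z] [VectorBundle ℂ G Z] [VectorBundle ℝ G Z]
  [ContMDiffVectorBundle ∞ G Z (𝓡 n)]

/-- Every point has a neighbourhood over which `A u` is controlled by `P u` and `u`. No comparison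
of charts is needed, because the right-hand side is already global. -/
theorem exists_local_estimate [CompactSpace M] [T2Space M]
    {μ : Measure M} (hμ : IsSmoothPositiveDensity n μ)
    {p : ℕ} {H : ∀ x : M, Submodule ℝ (TangentSpace (𝓡 n) x)} (hH : IsFoliation p H)
    (hV : HermitianMetric n E V) (hW : HermitianMetric n F W) (hZ : HermitianMetric n G Z)
    {d : ℕ} {P : Cₛ^∞⟮𝓡 n; E, V⟯ →ₗ[ℝ] Cₛ^∞⟮𝓡 n; F, W⟯} (hP : IsWeightedDiffOp p H d P)
    (hσ : HasInvertibleWeightedSymbol p H d P)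
    {A : Cₛ^∞⟮𝓡 n; E, V⟯ →ₗ[ℝ] Cₛ^∞⟮𝓡 n; G, Z⟯} (hA : IsWeightedDiffOp p H d A) (x₀ : M) :
    ∃ U : Set M, IsOpen U ∧ x₀ ∈ U ∧ ∃ C : ℝ, 0 ≤ C ∧ ∀ u : Cₛ^∞⟮𝓡 n; E, V⟯,
      ∫ x in U, (hZ.form x (A u x) (A u x)).re ∂μ ≤
        C * ((∫ x, (hW.form x (P u x) (P u x)).re ∂μ) +
          ∫ x, (hV.form x (u x) (u x)).re ∂μ) := by
  obtain ⟨φ, hx₀, hφ⟩ := hH.exists_chart x₀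
  set eV := trivializationAt E V x₀
  set eW := trivializationAt F W x₀
  set eZ := trivializationAt G Z x₀
  have heV : x₀ ∈ eV.baseSet := FiberBundle.mem_baseSet_trivializationAt' x₀
  have heW : x₀ ∈ eW.baseSet := FiberBundle.mem_baseSet_trivializationAt' x₀
  have heZ : x₀ ∈ eZ.baseSet := FiberBundle.mem_baseSet_trivializationAt' x₀
  obtain ⟨a, ha⟩ := hP φ eV eW hφ inferInstance inferInstance
  obtain ⟨b, hb⟩ := hA φ eV eZ hφ inferInstance inferInstance
  obtain ⟨ρ, hρ, hρ0, hμρ⟩ := hμ φ hφ.1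
  obtain ⟨CV, hCV, hVev⟩ := hV.eventually_comparable eV heV
  obtain ⟨CW, hCW, hWev⟩ := hW.eventually_comparable eW heW
  obtain ⟨CZ, hCZ, hZev⟩ := hZ.eventually_comparable eZ heZ
  set y₀ := φ x₀ with hy₀
  have hy₀t : y₀ ∈ φ.target := φ.map_source hx₀
  have hsymm : Filter.Tendsto φ.symm (nhds y₀) (nhds x₀) := by
    have := φ.continuousAt_symm hy₀t
    rwa [ContinuousAt, hy₀, φ.left_inv hx₀] at this
  -- a neighbourhood in which all the local data are under control
  obtain ⟨Ω, hΩ, hΩo, hyΩ⟩ := eventually_nhds_iff.1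
    ((φ.open_target.eventually_mem hy₀t).and
      ((hsymm.eventually hVev).and ((hsymm.eventually hWev).and (hsymm.eventually hZev))))
  have hΩt : Ω ⊆ φ.target := fun y hy => (hΩ y hy).1
  have hΩV : ∀ y ∈ Ω, φ.symm y ∈ eV.baseSet := fun y hy => (hΩ y hy).2.1.1
  have hΩP : Ω ⊆ localDomain φ eV eW := fun y hy =>
    ⟨hΩt hy, hΩV y hy, (hΩ y hy).2.2.1.1⟩
  have hΩA : Ω ⊆ localDomain φ eV eZ := fun y hy =>
    ⟨hΩt hy, hΩV y hy, (hΩ y hy).2.2.2.1⟩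
  obtain ⟨R, hR, hRΩ, C, hC, hest⟩ := exists_interior_estimate hΩo hyΩ
    (fun α hα => ((ha.smooth α hα).mono hΩP).continuousOn)
    (fun η hη => hσ φ eV eW hφ inferInstance inferInstance a ha y₀ (hΩP hyΩ) η hη)
  set K := Metric.closedBall y₀ R with hK
  have hKc : IsCompact K := isCompact_closedBall _ _
  have hKt : K ⊆ φ.target := hRΩ.trans hΩt
  set B := Metric.ball y₀ (R / 2) with hB
  have hBK : B ⊆ K :=
    Metric.ball_subset_closedBall.trans (Metric.closedBall_subset_closedBall (by linarith))
  obtain ⟨c, hc, hcρ⟩ := hKc.exists_forall_le' (hρ.continuousOn.mono hKt)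
    fun y hy => hρ0 y (hKt hy)
  obtain ⟨Cρ, hCρ⟩ := hKc.exists_bound_of_continuousOn (hρ.continuousOn.mono hKt)
  have hCρ0 : 0 ≤ Cρ := (norm_nonneg _).trans (hCρ y₀ (Metric.mem_closedBall_self hR.le))
  obtain ⟨Mb, hMb0, hMb⟩ : ∃ Mb : ℝ, 0 ≤ Mb ∧ ∀ α ∈ multiIndices n p d, ∀ y ∈ K, ‖b α y‖ ≤ Mb := by
    have h1 : ∀ α : multiIndices n p d, ∃ m : ℝ, ∀ y ∈ K, ‖b α y‖ ≤ m := fun α =>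
      hKc.exists_bound_of_continuousOn
        ((hb.smooth α α.2).continuousOn.mono (hRΩ.trans hΩA))
    choose m hm using h1
    have hm0 : ∀ α, 0 ≤ m α := fun α =>
      (norm_nonneg _).trans (hm α y₀ (Metric.mem_closedBall_self hR.le))
    exact ⟨∑ α, m α, Finset.sum_nonneg fun α _ => hm0 α, fun α hα y hy =>
      (hm ⟨α, hα⟩ y hy).trans
        (Finset.single_le_sum (fun α _ => hm0 α) (Finset.mem_univ (⟨α, hα⟩ : multiIndices n p d)))⟩
  set N : ℝ := ((multiIndices n p d).card : ℝ) with hN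
  refine ⟨φ.source ∩ φ ⁻¹' B, φ.isOpen_inter_preimage Metric.isOpen_ball,
    ⟨hx₀, Metric.mem_ball_self (by positivity)⟩,
    Cρ * CZ * (N * Mb ^ 2 * (N * (C * (CW / c + CV / c)))), by positivity, fun u => ?_⟩
  set v := localSection φ eV u with hv
  have hvs : ContDiffOn ℝ ∞ v Ω := contDiffOn_localSection hφ.1 eV u hΩt hΩV
  have hvest := hest v hvs
  set IP := ∫ x, (hW.form x (P u x) (P u x)).re ∂μ with hIP
  set IV := ∫ x, (hV.form x (u x) (u x)).re ∂μ with hIV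
  have hIP0 : 0 ≤ IP := integral_nonneg fun x => hW.form_self_nonneg x _
  have hIV0 : 0 ≤ IV := integral_nonneg fun x => hV.form_self_nonneg x _
  have bV : ∫ y in K, ‖v y‖ ^ 2 ≤ CV / c * IV :=
    integral_localSection_le hμ hV hρ.continuousOn hρ0 hμρ eV hKc hKt hc hCV.le hcρ
      (fun y hy s => ((hΩ y (hRΩ hy)).2.1.2 s).1) u
  have bP : ∫ y in K, ‖∑ α ∈ multiIndices n p d, a α y (multiDeriv α v y)‖ ^ 2 ≤ CW / c * IP := by
    refine le_trans (le_of_eq ?_)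
      (integral_localSection_le hμ hW hρ.continuousOn hρ0 hμρ eW hKc hKt hc hCW.le hcρ
        (fun y hy s => ((hΩ y (hRΩ hy)).2.2.1.2 s).1) (P u))
    refine setIntegral_congr_fun hKc.measurableSet fun y hy => ?_
    exact congrArg (fun z => ‖z‖ ^ 2) (ha.eq_sum u y (hΩP (hRΩ hy))).symm
  have hpt : ∀ y ∈ B, ρ y * (hZ.form (φ.symm y) (A u (φ.symm y)) (A u (φ.symm y))).re ≤
      Cρ * CZ * (N * Mb ^ 2) * ∑ α ∈ multiIndices n p d, ‖multiDeriv α v y‖ ^ 2 := by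
    intro y hy
    have hyK := hBK hy
    have h1 := ((hΩ y (hRΩ hyK)).2.2.2.2 (A u (φ.symm y))).2
    have h2 : (eZ ⟨φ.symm y, A u (φ.symm y)⟩).2 =
        ∑ α ∈ multiIndices n p d, b α y (multiDeriv α v y) := hb.eq_sum u y (hΩA (hRΩ hyK))
    have h3 : ‖∑ α ∈ multiIndices n p d, b α y (multiDeriv α v y)‖ ^ 2 ≤
        N * Mb ^ 2 * ∑ α ∈ multiIndices n p d, ‖multiDeriv α v y‖ ^ 2 :=
      norm_sum_clm_sq_le _ (fun α hα => hMb α hα y hyK) _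
    rw [h2] at h1
    have h4 : ρ y ≤ Cρ := (le_abs_self _).trans (hCρ y hyK)
    calc _ ≤ Cρ * (CZ * (N * Mb ^ 2 * ∑ α ∈ multiIndices n p d, ‖multiDeriv α v y‖ ^ 2)) :=
          mul_le_mul h4 (h1.trans (by gcongr)) (hZ.form_self_nonneg _ _) hCρ0
      _ = _ := by ring
  rw [setIntegral_preimage_chart hρ.continuousOn hρ0 hμρ Metric.isOpen_ball.measurableSet
    (hBK.trans hKt) (hZ.continuous_form_self (A u))]
  have hint : IntegrableOn (fun y => ∑ α ∈ multiIndices n p d, ‖multiDeriv α v y‖ ^ 2) B :=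
    integrable_finsetSum _ fun α hα => (hvest α hα).1
  have hsum : ∫ y in B, ∑ α ∈ multiIndices n p d, ‖multiDeriv α v y‖ ^ 2 ≤
      N * (C * (CW / c * IP + CV / c * IV)) := by
    rw [integral_finsetSum _ fun α hα => (hvest α hα).1, hN, ← nsmul_eq_mul]
    refine Finset.sum_le_card_nsmul _ _ _ fun α hα => (hvest α hα).2.trans ?_
    exact mul_le_mul_of_nonneg_left (add_le_add bP bV) hC
  calc _ ≤ ∫ y in B, Cρ * CZ * (N * Mb ^ 2) *
        ∑ α ∈ multiIndices n p d, ‖multiDeriv α v y‖ ^ 2 := by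
        refine integral_mono_of_nonneg ?_ (hint.const_mul _) ?_
        · exact (ae_restrict_iff' Metric.isOpen_ball.measurableSet).2
            (Filter.Eventually.of_forall fun y hy =>
              mul_nonneg (hρ0 y (hKt (hBK hy))).le (hZ.form_self_nonneg _ _))
        · exact (ae_restrict_iff' Metric.isOpen_ball.measurableSet).2
            (Filter.Eventually.of_forall fun y hy => hpt y hy)
    _ ≤ Cρ * CZ * (N * Mb ^ 2) * (N * (C * (CW / c * IP + CV / c * IV))) := by
        rw [integral_const_mul]
        gcongr
    _ ≤ Cρ * CZ * (N * Mb ^ 2) * (N * (C * ((CW / c + CV / c) * (IP + IV)))) := by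
        have e1 : 0 ≤ CW / c * IV := by positivity
        have e2 : 0 ≤ CV / c * IP := by positivity
        gcongr
        linarith
    _ = _ := by ring

end Global
end WeightedCalculus
end

theorem mainTheorem6
    {n : ℕ} {M : Type*} [TopologicalSpace M] [ChartedSpace (EuclideanSpace ℝ (Fin n)) M]
    [IsManifold (𝓡 n) ∞ M] [CompactSpace M] [T2Space M]
    [MeasurableSpace M] [BorelSpace M]
    (μ : Measure M) (hμ : WeightedCalculus.IsSmoothPositiveDensity n μ)
    (p : ℕ) (H : ∀ x : M, Submodule ℝ (TangentSpace (𝓡 n) x))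
    (hH : WeightedCalculus.IsFoliation p H)
    {E : Type*} [NormedAddCommGroup E] [NormedSpace ℂ E] [FiniteDimensional ℂ E]
    {V : M → Type*} [TopologicalSpace (TotalSpace E V)] [∀ x, TopologicalSpace (V x)]
    [∀ x, AddCommGroup (V x)] [∀ x, Module ℂ (V x)]
    [FiberBundle E V] [VectorBundle ℂ E V] [VectorBundle ℝ E V]
    [ContMDiffVectorBundle ∞ E V (𝓡 n)]
    (hV : WeightedCalculus.HermitianMetric n E V)
    {F : Type*} [NormedAddCommGroup F] [NormedSpace ℂ F] [FiniteDimensional ℂ F]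
    {W : M → Type*} [TopologicalSpace (TotalSpace F W)] [∀ x, TopologicalSpace (W x)]
    [∀ x, AddCommGroup (W x)] [∀ x, Module ℂ (W x)]
    [FiberBundle F W] [VectorBundle ℂ F W] [VectorBundle ℝ F W]
    [ContMDiffVectorBundle ∞ F W (𝓡 n)]
    (hW : WeightedCalculus.HermitianMetric n F W)
    (d : ℕ) (P : Cₛ^∞⟮𝓡 n; E, V⟯ →ₗ[ℝ] Cₛ^∞⟮𝓡 n; F, W⟯)
    (hP : WeightedCalculus.IsWeightedDiffOp p H d P)
    (hσ : WeightedCalculus.HasInvertibleWeightedSymbol p H d P)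
    {G : Type*} [NormedAddCommGroup G] [NormedSpace ℂ G] [FiniteDimensional ℂ G]
    {Z : M → Type*} [TopologicalSpace (TotalSpace G Z)] [∀ x, TopologicalSpace (Z x)]
    [∀ x, AddCommGroup (Z x)] [∀ x, Module ℂ (Z x)]
    [FiberBundle G Z] [VectorBundle ℂ G Z] [VectorBundle ℝ G Z]
    [ContMDiffVectorBundle ∞ G Z (𝓡 n)]
    (hZ : WeightedCalculus.HermitianMetric n G Z)
    (A : Cₛ^∞⟮𝓡 n; E, V⟯ →ₗ[ℝ] Cₛ^∞⟮𝓡 n; G, Z⟯)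
    (hA : WeightedCalculus.IsWeightedDiffOp p H d A) :
    ∃ C : ℝ, 0 < C ∧ ∀ u : Cₛ^∞⟮𝓡 n; E, V⟯,
      WeightedCalculus.l2Norm μ hZ (A u) ≤
        C * (WeightedCalculus.l2Norm μ hW (P u) + WeightedCalculus.l2Norm μ hV u) := by
  choose U hUo hxU C hC hest using
    WeightedCalculus.exists_local_estimate hμ hH hV hW hZ hP hσ hA
  obtain ⟨t, ht⟩ := isCompact_univ.elim_finite_subcover U hUo
    fun x _ => Set.mem_iUnion.2 ⟨x, hxU x⟩
  set D : ℝ := ∑ x ∈ t, C x with hD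
  have hD0 : 0 ≤ D := Finset.sum_nonneg fun x _ => hC x
  refine ⟨√D + 1, by positivity, fun u => ?_⟩
  set f : M → ℝ := fun x => (hZ.form x (A u x) (A u x)).re with hf
  have hfc : Continuous f := hZ.continuous_form_self (A u)
  have hfi : Integrable f μ := WeightedCalculus.integrable_of_continuous hμ hfc
  have hf0 : ∀ x, 0 ≤ f x := fun x => hZ.form_self_nonneg x _
  set IP := ∫ x, (hW.form x (P u x) (P u x)).re ∂μ with hIP
  set IV := ∫ x, (hV.form x (u x) (u x)).re ∂μ with hIV
  have hIP0 : 0 ≤ IP := integral_nonneg fun x => hW.form_self_nonneg x _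
  have hIV0 : 0 ≤ IV := integral_nonneg fun x => hV.form_self_nonneg x _
  have hle : ∫ x, f x ∂μ ≤ D * (IP + IV) := by
    calc ∫ x, f x ∂μ ≤ ∫ x, ∑ z ∈ t, (U z).indicator f x ∂μ := by
          refine integral_mono hfi (integrable_finsetSum _ fun z _ =>
            hfi.indicator (hUo z).measurableSet) fun x => ?_
          obtain ⟨z, hz, hxz⟩ := Set.mem_iUnion₂.1 (ht (Set.mem_univ x))
          calc f x = (U z).indicator f x := (Set.indicator_of_mem hxz f).symm
            _ ≤ _ := Finset.single_le_sum (f := fun z => (U z).indicator f x)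
              (fun z _ => Set.indicator_nonneg (fun x _ => hf0 x) x) hz
      _ = ∑ z ∈ t, ∫ x in U z, f x ∂μ := by
          rw [integral_finsetSum _ fun z _ => hfi.indicator (hUo z).measurableSet]
          exact Finset.sum_congr rfl fun z _ => integral_indicator (hUo z).measurableSet
      _ ≤ ∑ z ∈ t, C z * (IP + IV) := Finset.sum_le_sum fun z _ => hest z u
      _ = _ := by rw [← Finset.sum_mul]
  calc √(∫ x, f x ∂μ) ≤ √(D * (IP + IV)) := Real.sqrt_le_sqrt hle
    _ = √D * √(IP + IV) := Real.sqrt_mul hD0 _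
    _ ≤ √D * (√IP + √IV) := by
        gcongr
        refine Real.sqrt_le_iff.2 ⟨by positivity, ?_⟩
        rw [add_sq, Real.sq_sqrt hIP0, Real.sq_sqrt hIV0]
        have : 0 ≤ 2 * √IP * √IV := by positivity
        linarith
    _ ≤ (√D + 1) * (√IP + √IV) := by
        gcongr
        linarith
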